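/- Let $M$ be a monoid, and let $M\times M^{op}$ act on $M$ by $(m_L,m_R)m=m_Lmm_R$. Let $\mathbb ZM$ denote the monoid ring. A \emph{projective $M\times M^{op}$-CW complex} is an $M\times M^{op}$-space $X=\varinjlim X_n$ such that $X_{-1}=\varnothing$ and, for each $n\ge 0$, $X_n$ is obtained as a pushout of $X_{n-1}$ and $P_n\times B^n$ along a continuous equivariant map $P_n\times S^{n-1}\to X_{n-1}$, where $P_n$ is a (discrete) projective $M\times M^{op}$-set and the ball $B^n$ carries the trivial action (so $X_0=P_0$); $X_n$ is \emph{$M\times M^{op}$-finite} if the $M\times M^{op}$-sets $P_0,\dots,P_n$ are finitely generated. The monoid $M$ is of \emph{type bi-$\mathrm F_n$} if there is a projective $M\times M^{op}$-CW complex $X$ such that $\pi_0(X)\cong M$ as $M\times M^{op}$-sets, each component of $X$ is contractible, and $X_n$ is $M\times M^{op}$-finite. It is of \emph{type bi-$\mathrm{FP}_n$} if there is an exact sequence $A_n\to A_{n-1}\to\cdots\to A_0\to\mathbb ZM\to 0$ of $(\mathbb ZM,\mathbb ZM)$-bimodules with $A_0,\dots,A_n$ finitely generated projective bimodules. For $A\subseteq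 M$, the \emph{two-sided Cayley digraph} $\overleftrightarrow{\Gamma(M,A)}$ has vertex set $M\times M$ and, for each $(m_L,m_R,a)\in M\times M\times A$, one edge from $(m_L,am_R)$ to $(m_La,m_R)$. Its set $\pi_0(\overleftrightarrow{\Gamma(M,A)})$ of (undirected) connected components carries the $M\times M^{op}$-action induced by $(m,m')\cdot(m_1,m_2)=(mm_1,m_2m')$, and there is a natural equivariant surjection $\pi_0(\overleftrightarrow{\Gamma(M,A)})\to M$ sending the component of $(m_1,m_2)$ to $m_1m_2$. The subset $A$ \emph{dominates} $M$ if any two monoid homomorphisms $f,g\colon M\to N$ into a monoid $N$ that agree on $A$ are equal. \textbf{Theorem.} The following are equivalent for a monoid $M$. \begin{enumerate} \item $M$ is of type bi-$\mathrm F_1$. \item $M$ is of type bi-$\mathrm{FP}_1$. \item There is a finite subset $A\subseteq M$ such that the natural map $\pi_0(\overleftrightarrow{\Gamma(M,A)})\to M$ is an isomorphism (equivalently, a bijection). \item There is a finite subset $A\subseteq M$ that dominates $M$. \end{enumerate} In particular, any finitely generated monoid is of type bi-$\mathrm F_1$. -/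

import Mathlib

universe u

open scoped TensorProduct

namespace BiFinite

/-! ### Sets with an action of a monoid -/

/-- A `G`-set `P` is projective if every surjective `G`-equivariant map onto `P` has a
`G`-equivariant section. -/
def IsProjectiveSet (G : Type u) [Monoid G] (P : Type u) [MulAction G P] : Prop :=
  ∀ (Y : Type u) [MulAction G Y] (f : Y →[G] P), Function.Surjective f →
    ∃ s : P →[G] Y, ∀ p, f (s p) = p

/-- A `G`-set `P` is finitely generated if it is a union of finitely many orbits `G • s`. -/
def IsFGSet (G : Type u) [Monoid G] (P : Type u) [MulAction G P] : Prop :=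
  ∃ S : Set P, S.Finite ∧ ∀ p : P, ∃ s ∈ S, ∃ g : G, g • s = p

/-! ### Projective equivariant CW complexes -/

/-- The closed unit ball `Bⁿ` in Euclidean `n`-space. -/
abbrev UnitBall (n : ℕ) : Type :=
  Metric.closedBall (0 : EuclideanSpace ℝ (Fin n)) 1

/-- The union of the images of the families of characteristic maps of dimension `< n`, that is,
the `(n-1)`-skeleton (empty for `n = 0`). -/
def skeletonLT {X : Type u} {cell : ℕ → Type u}
    (char : (n : ℕ) → cell n → UnitBall n → X) (n : ℕ) : Set X :=
  {x | ∃ k < n, ∃ (c : cell k) (b : UnitBall k), char k c b = x}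

/-- The structure of a projective `G`-CW complex on a `G`-space `X` (`G` a discrete monoid).
For every `n`, the `n`-skeleton `Xₙ = skeletonLT char (n + 1)` is the pushout of the
`(n-1)`-skeleton `Xₙ₋₁ = skeletonLT char n` and `Pₙ × Bⁿ` along an equivariant map
`Pₙ × Sⁿ⁻¹ → Xₙ₋₁`, where `Pₙ = cell n` is a projective discrete `G`-set and `Bⁿ` has the trivial
action; and `X` is the direct limit of its skeleta. (For `n = 0`, `X₋₁` and `S⁻¹` are empty, and
the conditions say that `X₀` is the discrete `G`-set `P₀`.) -/
structure ProjectiveCWStructure (G : Type u) [Monoid G] (X : Type u) [TopologicalSpace X]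
    [MulAction G X] where
  /-- The `G`-set `Pₙ` indexing the `n`-cells. -/
  cell : ℕ → Type u
  /-- The action of `G` on the `n`-cells. -/
  cellAction : ∀ n, MulAction G (cell n)
  /-- The set of `n`-cells is a projective `G`-set. -/
  projective : ∀ n, IsProjectiveSet G (cell n)
  /-- The map `Pₙ × Bⁿ → X`: for every `n`-cell its characteristic map. -/
  char : (n : ℕ) → cell n → UnitBall n → X
  /-- The map `Pₙ × Bⁿ → X` is continuous ... -/
  continuous_char : ∀ n c, Continuous (char n c)
  /-- ... and equivariant. -/
  char_smul : ∀ n (g : G) (c : cell n) (b : UnitBall n), char n (g • c) b = g • char n c b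
  /-- Boundary spheres are attached to the previous skeleton. -/
  char_sphere : ∀ n c (b : UnitBall n), ‖b.1‖ = 1 → char n c b ∈ skeletonLT char n
  /-- Open cells are disjoint from the previous skeleton. -/
  char_ball : ∀ n c (b : UnitBall n), ‖b.1‖ < 1 → char n c b ∉ skeletonLT char n
  /-- The map `Pₙ × Bⁿ → X` is injective on the product of `Pₙ` and the open ball. -/
  char_injOn : ∀ n c c' (b b' : UnitBall n), ‖b.1‖ < 1 → ‖b'.1‖ < 1 →
    char n c b = char n c' b' → c = c' ∧ b = b'
  /-- `X` is the union of its skeleta. -/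
  exists_mem_skeletonLT : ∀ x : X, ∃ n, x ∈ skeletonLT char n
  /-- Skeleta are closed subspaces. -/
  isClosed_skeletonLT : ∀ n, IsClosed (skeletonLT char n)
  /-- The `n`-skeleton has the pushout topology. -/
  isClosed_of_pushout : ∀ n (C : Set X), C ⊆ skeletonLT char (n + 1) →
    IsClosed (C ∩ skeletonLT char n) → (∀ c, IsClosed (char n c ⁻¹' C)) → IsClosed C
  /-- `X` has the direct limit topology. -/
  isClosed_of_colimit : ∀ C : Set X, (∀ n, IsClosed (C ∩ skeletonLT char n)) → IsClosed C

attribute [instance] ProjectiveCWStructure.cellAction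

/-! ### Bi-equivariant classifying spaces and type bi-`Fₙ` -/

/-- The topological condition on a bi-equivariant classifying space `X` for `M`: the set `π₀(X)`
of (path) components is isomorphic to `M` as an `M × Mᵐᵒᵖ`-set, where
`(m_L, m_R) • m = m_L * m * m_R` on `M`, and every component is contractible. -/
def HasContractibleComponentsIndexedBy (M X : Type u) [Monoid M] [TopologicalSpace X]
    [MulAction (M × Mᵐᵒᵖ) X] : Prop :=
  (∃ φ : ZerothHomotopy X ≃ M, ∀ (g : M × Mᵐᵒᵖ) (x : X),
      φ (ZerothHomotopy.mk (g • x)) = g.1 * φ (ZerothHomotopy.mk x) * g.2.unop) ∧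
    ∀ x : X, ContractibleSpace (pathComponent x)

/-- `M` is of type bi-`Fₙ`: there is a bi-equivariant classifying space for `M`, that is, a
projective `M × Mᵐᵒᵖ`-CW complex `X` with `π₀(X) ≅ M` and contractible components, whose
`n`-skeleton is built from finitely many `M × Mᵐᵒᵖ`-cells. -/
def IsBiF (M : Type u) [Monoid M] (n : ℕ) : Prop :=
  ∃ (X : Type u) (_ : TopologicalSpace X) (_ : MulAction (M × Mᵐᵒᵖ) X)
    (_ : ContinuousConstSMul (M × Mᵐᵒᵖ) X) (S : ProjectiveCWStructure (M × Mᵐᵒᵖ) X),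
    HasContractibleComponentsIndexedBy M X ∧
      ∀ k ≤ n, IsFGSet (M × Mᵐᵒᵖ) (S.cell k)

/-! ### Type bi-`FPₙ` -/

/-- The ring `ℤM ⊗ (ℤM)ᵐᵒᵖ`; its left modules are the `(ℤM, ℤM)`-bimodules. -/
abbrev EnvelopingRing (M : Type u) [Monoid M] : Type u :=
  MonoidAlgebra ℤ M ⊗[ℤ] (MonoidAlgebra ℤ M)ᵐᵒᵖ

/-- `ℤM` as a bimodule over itself: `(a ⊗ op b) • x = a * x * b`. -/
noncomputable instance bimoduleSelf (M : Type u) [Monoid M] :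
    Module (EnvelopingRing M) (MonoidAlgebra ℤ M) :=
  TensorProduct.Algebra.module

/-- `M` is of type bi-`FPₙ`: there is a partial resolution
`Aₙ → ⋯ → A₁ → A₀ → ℤM → 0` of the bimodule `ℤM` by finitely generated projective bimodules.
(The modules `A i` with `i > n` and the maps between them play no role.) -/
def IsBiFP (M : Type u) [Monoid M] (n : ℕ) : Prop :=
  ∃ (A : ℕ → Type u) (_ : ∀ i, AddCommGroup (A i)) (_ : ∀ i, Module (EnvelopingRing M) (A i))
    (d : ∀ i, A (i + 1) →ₗ[EnvelopingRing M] A i)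
    (ε : A 0 →ₗ[EnvelopingRing M] MonoidAlgebra ℤ M),
    (∀ i ≤ n, Module.Finite (EnvelopingRing M) (A i) ∧ Module.Projective (EnvelopingRing M) (A i)) ∧
    Function.Surjective ε ∧
    (1 ≤ n → Function.Exact (d 0) ε) ∧
    ∀ i, i + 2 ≤ n → Function.Exact (d (i + 1)) (d i)

/-! ### The two-sided Cayley digraph -/

/-- The vertex set `M × M` of the two-sided Cayley digraph of `M` with respect to `A`. -/
@[nolint unusedArguments]
def TwoSidedCayley {M : Type u} (_A : Set M) : Type u := M × M

/-- The edges of the two-sided Cayley digraph: `(m_L, m_R, a)` with `a ∈ A` is an edge from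
`(m_L, a * m_R)` to `(m_L * a, m_R)`. -/
instance twoSidedCayleyQuiver {M : Type u} [Monoid M] (A : Set M) :
    Quiver.{u} (TwoSidedCayley A) where
  Hom v w := {e : M × M × A //
    v = (e.1, (e.2.2 : M) * e.2.1) ∧ w = (e.1 * (e.2.2 : M), e.2.1)}

theorem mul_eq_of_path {M : Type u} [Monoid M] (A : Set M)
    {v w : Quiver.Symmetrify (TwoSidedCayley A)} (p : Quiver.Path v w) :
    (show M × M from v).1 * (show M × M from v).2 =
      (show M × M from w).1 * (show M × M from w).2 := by
  induction p with
  | nil => rfl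
  | cons _ e ih =>
    refine ih.trans ?_
    rcases e with ⟨e, h₁, h₂⟩ | ⟨e, h₁, h₂⟩
    · rw [h₁, h₂]; exact (mul_assoc _ _ _).symm
    · rw [h₁, h₂]; exact mul_assoc _ _ _

/-- The natural map `π₀(Γ(M, A)) → M` from the (weak) components of the two-sided Cayley digraph
to `M`, sending the component of `(m₁, m₂)` to `m₁ * m₂`. It is `M × Mᵐᵒᵖ`-equivariant and
surjective for every `A`. -/
def componentToMonoid {M : Type u} [Monoid M] (A : Set M) :
    Quiver.WeaklyConnectedComponent (TwoSidedCayley A) → M :=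
  Quotient.lift (fun v : M × M => v.1 * v.2) fun _ _ h => h.elim fun p => mul_eq_of_path A p

/-! ### Domination -/

/-- `A` dominates `M`: monoid homomorphisms out of `M` that agree on `A` are equal. -/
def Dominates {M : Type u} [Monoid M] (A : Set M) : Prop :=
  ∀ (N : Type u) [Monoid N] (f g : M →* N), (∀ a ∈ A, f a = g a) → f = g

end BiFinite

/-! Domination is the hub: both finiteness conditions imply it, it implies bijectivity of `π₀ → M`,
and that bijectivity rebuilds both a resolution and a classifying space.

From domination to the graph: let `C` be the set of components. `M` acts on `M × ℤC` by left
multiplication, and also by the conjugate of this action under the shear `(n, c) ↦ (n, c + [1, n])`.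
The two actions of `m` differ by `[m, n] - [1, mn]`, which vanishes for `m ∈ A` because of the
edges. Domination makes it vanish for every `m`, so each component is determined by its product
(`Dominates.component_eq`).

From finiteness to domination: let `f` and `g` be homomorphisms to `N`. Twist the target by letting
`M` act on the left through `f` and on the right through `g`. Projectivity of the degree-zero term
writes each element through a free cover, and this defines an equivariant map `Θ` (on bimodules) or
`θ` (on vertices) into the twisted target. It agrees with the untwisted map induced by `f` wherever
`f` and `g` agree on the right coefficients that occur. Finitely many coefficients are enough to
cover a lift of `1` and the boundaries of generating 1-cells. Then the twisted map is constant on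
components, or zero on `ker ε`; comparing `m · 1` with `1 · m` gives `f m = g m`. In the topological
case, constancy on path components is `ProjectiveCWStructure.eq_of_joined`.

From the graph to finiteness: algebraically, edges generate the kernel of the augmentation
(`exact_cayleyBoundary_augmentation`). Topologically, start with the free vertex set and the free
edges indexed by `A`, then attach a free cell along every map of a sphere of positive dimension that
lies over one element of `M`. Only cells of dimension at most one have to be finite in number. Each
fibre over `M` is contracted by building, cell by cell, a continuous choice of path to a chosen
vertex (`exists_fibrewise_contraction`). Using maps into the path space `C(I, X)` avoids a cell
structure on `X × I`. -/

namespace BiFinite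

/-! ### Domination and the two-sided Cayley digraph -/

section Domination

variable {M : Type u} [Monoid M] (A : Set M)

/-- The component of a vertex of the two-sided Cayley digraph. -/
def component (v : M × M) : Quiver.WeaklyConnectedComponent (TwoSidedCayley A) :=
  Quotient.mk _ v

theorem component_eq_of_mem {a : M} (ha : a ∈ A) (x y : M) :
    component A (x, a * y) = component A (x * a, y) := by
  refine Quotient.sound ⟨?_⟩
  exact Quiver.Hom.toPath (Sum.inl ⟨(x, y, ⟨a, ha⟩), rfl, rfl⟩)

theorem eqvGen_of_path {v w : Quiver.Symmetrify (TwoSidedCayley A)} (p : Quiver.Path v w) :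
    Relation.EqvGen (fun v w : M × M => ∃ x y, ∃ a ∈ A, v = (x, a * y) ∧ w = (x * a, y)) v w := by
  induction p with
  | nil => exact .refl _
  | cons _ e ih =>
    refine ih.trans _ _ _ ?_
    rcases e with ⟨⟨x, y, a⟩, h₁, h₂⟩ | ⟨⟨x, y, a⟩, h₁, h₂⟩
    · exact .rel _ _ ⟨x, y, a, a.2, h₁, h₂⟩
    · exact .symm _ _ (.rel _ _ ⟨x, y, a, a.2, h₁, h₂⟩)

/-- Components are the classes of the equivalence relation generated by the edges. -/
theorem component_eq_iff {v w : M × M} : component A v = component A w ↔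
    Relation.EqvGen (fun v w : M × M => ∃ x y, ∃ a ∈ A, v = (x, a * y) ∧ w = (x * a, y)) v w := by
  constructor
  · intro h
    obtain ⟨p⟩ := Quotient.exact h
    exact eqvGen_of_path A p
  · intro h
    induction h with
    | rel v w h =>
      obtain ⟨x, y, a, ha, rfl, rfl⟩ := h
      exact component_eq_of_mem A ha x y
    | refl => rfl
    | symm _ _ _ ih => exact ih.symm
    | trans _ _ _ _ _ ih₁ ih₂ => exact ih₁.trans ih₂

/-- The left action of `M` on the components of the two-sided Cayley digraph. -/
def componentLeftMul (m : M) (c : Quiver.WeaklyConnectedComponent (TwoSidedCayley A)) :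
    Quiver.WeaklyConnectedComponent (TwoSidedCayley A) :=
  Quotient.lift (fun v : M × M => component A (m * v.1, v.2)) (by
    intro v w h
    have h' := (component_eq_iff A).1 (Quotient.sound h : component A v = component A w)
    clear h
    induction h' with
    | rel v w h =>
      obtain ⟨x, y, a, ha, rfl, rfl⟩ := h
      simpa [mul_assoc] using component_eq_of_mem A ha (m * x) y
    | refl => rfl
    | symm _ _ _ ih => exact ih.symm
    | trans _ _ _ _ _ ih₁ ih₂ => exact ih₁.trans ih₂) c

theorem componentLeftMul_component (m x y : M) :
    componentLeftMul A m (component A (x, y)) = component A (m * x, y) := rfl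

theorem componentLeftMul_one (c) : componentLeftMul A 1 c = c := by
  induction c using Quotient.inductionOn with
  | h v => exact congrArg (component A) (Prod.ext (one_mul _) rfl)

theorem componentLeftMul_mul (m n : M) (c) :
    componentLeftMul A (m * n) c = componentLeftMul A m (componentLeftMul A n c) := by
  induction c using Quotient.inductionOn with
  | h v => exact congrArg (component A) (Prod.ext (mul_assoc _ _ _) rfl)

/-- `M` acts on `M × ℤC`, where `C` is the set of components, by left multiplication. -/
noncomputable def leftMulEnd :
    M →* Function.End (M × (Quiver.WeaklyConnectedComponent (TwoSidedCayley A) →₀ ℤ)) where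
  toFun m z := (m * z.1, z.2.mapDomain (componentLeftMul A m))
  map_one' := by
    funext z
    have : componentLeftMul A (1 : M) = id := funext (componentLeftMul_one A)
    change (1 * z.1, z.2.mapDomain (componentLeftMul A 1)) = z
    rw [this, Finsupp.mapDomain_id, one_mul]
  map_mul' m n := by
    funext z
    have : componentLeftMul A (m * n) = componentLeftMul A m ∘ componentLeftMul A n :=
      funext (componentLeftMul_mul A m n)
    refine Prod.ext (mul_assoc _ _ _) ?_
    simp only [this, Finsupp.mapDomain_comp]
    rfl

/-- The action `leftMulEnd` conjugated by the shear `(n, c) ↦ (n, c + [1, n])`. -/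
noncomputable def shearedLeftMulEnd :
    M →* Function.End (M × (Quiver.WeaklyConnectedComponent (TwoSidedCayley A) →₀ ℤ)) where
  toFun m z := (m * z.1, z.2.mapDomain (componentLeftMul A m) +
    (Finsupp.single (component A (m, z.1)) 1 - Finsupp.single (component A (1, m * z.1)) 1))
  map_one' := by
    funext z
    have : componentLeftMul A (1 : M) = id := funext (componentLeftMul_one A)
    refine Prod.ext (one_mul _) ?_
    change z.2.mapDomain (componentLeftMul A 1) + (Finsupp.single (component A (1, z.1)) 1 -
      Finsupp.single (component A (1, 1 * z.1)) 1) = z.2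
    rw [this, Finsupp.mapDomain_id, one_mul, sub_self, add_zero]
  map_mul' m n := by
    funext z
    have : componentLeftMul A (m * n) = componentLeftMul A m ∘ componentLeftMul A n :=
      funext (componentLeftMul_mul A m n)
    refine Prod.ext (mul_assoc _ _ _) ?_
    change _ = (((z.2.mapDomain (componentLeftMul A n)) + (Finsupp.single (component A (n, z.1)) 1
      - Finsupp.single (component A (1, n * z.1)) 1)).mapDomain (componentLeftMul A m)) +
        (Finsupp.single (component A (m, n * z.1)) 1
          - Finsupp.single (component A (1, m * (n * z.1))) 1)
    simp only [this, Finsupp.mapDomain_comp, Finsupp.mapDomain_add, sub_eq_add_neg,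
      ← Finsupp.single_neg, Finsupp.mapDomain_single, componentLeftMul_component, mul_one,
      mul_assoc]
    simp only [Finsupp.single_neg]
    abel

variable {A}

/-- The plain and sheared actions agree on `A`, since an edge identifies `[a, n]` with `[1, an]`;
domination forces them to agree at `x`. -/
theorem Dominates.component_eq (hA : Dominates A) (x y : M) :
    component A (x, y) = component A (1, x * y) := by
  have h := hA _ (leftMulEnd A) (shearedLeftMulEnd A) fun a ha => by
    funext z
    refine Prod.ext rfl ?_
    have := component_eq_of_mem A ha 1 z.1
    rw [one_mul] at this
    change z.2.mapDomain (componentLeftMul A a) = z.2.mapDomain (componentLeftMul A a) +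
      (Finsupp.single (component A (a, z.1)) 1 - Finsupp.single (component A (1, a * z.1)) 1)
    rw [this, sub_self, add_zero]
  -- At `(y, 0)` only the correction term `[x, y] - [1, xy]` of the sheared action survives.
  have h' := congrArg Prod.snd (congrFun (DFunLike.congr_fun h x) (y, 0))
  change (0 : _ →₀ ℤ).mapDomain (componentLeftMul A x) =
    (0 : _ →₀ ℤ).mapDomain (componentLeftMul A x) +
      (Finsupp.single (component A (x, y)) 1 - Finsupp.single (component A (1, x * y)) 1) at h'
  rw [Finsupp.mapDomain_zero, zero_add] at h'
  exact Finsupp.single_left_injective one_ne_zero (sub_eq_zero.1 h'.symm)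

theorem Dominates.bijective_componentToMonoid (hA : Dominates A) :
    Function.Bijective (componentToMonoid A) := by
  constructor
  · intro c d
    induction c, d using Quotient.inductionOn₂ with
    | h v w =>
      intro h
      have h : v.1 * v.2 = w.1 * w.2 := h
      change component A (v.1, v.2) = component A (w.1, w.2)
      rw [hA.component_eq, h, ← hA.component_eq]
  · intro m
    exact ⟨component A (m, 1), mul_one m⟩

theorem dominates_of_closure_eq_top (hA : Submonoid.closure A = ⊤) : Dominates A :=
  fun _ _ _ _ h => MonoidHom.eq_of_eqOn_denseM hA h

end Domination

/-! ### Bimodule resolutions -/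

section Bimodules

variable {M : Type u} [Monoid M]

/-- The element `x ⊗ op y` of the enveloping ring. -/
noncomputable def tmulOf (x y : M) : EnvelopingRing M :=
  MonoidAlgebra.of ℤ M x ⊗ₜ[ℤ] MulOpposite.op (MonoidAlgebra.of ℤ M y)

theorem tmulOf_mul (x y x' y' : M) :
    tmulOf x y * tmulOf x' y' = tmulOf (x * x') (y' * y) := by
  simp only [tmulOf, Algebra.TensorProduct.tmul_mul_tmul, ← MulOpposite.op_mul, map_mul]

theorem tmul_smul (a : MonoidAlgebra ℤ M) (b : (MonoidAlgebra ℤ M)ᵐᵒᵖ) (x : MonoidAlgebra ℤ M) :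
    (a ⊗ₜ[ℤ] b : EnvelopingRing M) • x = a * x * b.unop := by
  rw [TensorProduct.Algebra.smul_def]
  simp [mul_assoc]

theorem tmulOf_smul (x y m : M) :
    tmulOf x y • MonoidAlgebra.of ℤ M m = MonoidAlgebra.of ℤ M (x * m * y) := by
  rw [tmulOf, tmul_smul]
  simp only [map_mul, MulOpposite.unop_op]

/-- The augmentation of the enveloping ring, `a ⊗ op b ↦ a * b`. -/
noncomputable def augmentation (M : Type u) [Monoid M] :
    EnvelopingRing M →ₗ[EnvelopingRing M] MonoidAlgebra ℤ M :=
  LinearMap.toSpanSingleton _ _ 1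

theorem augmentation_tmulOf (x y : M) :
    augmentation M (tmulOf x y) = MonoidAlgebra.of ℤ M (x * y) := by
  have := tmulOf_smul x y 1
  rwa [map_one, mul_one] at this

/-- Induction principle: the enveloping ring is spanned by the `x ⊗ op y`. -/
theorem EnvelopingRing.induction {p : EnvelopingRing M → Prop} (h0 : p 0)
    (hadd : ∀ a b, p a → p b → p (a + b)) (hneg : ∀ a, p a → p (-a))
    (hof : ∀ x y, p (tmulOf x y)) (z : EnvelopingRing M) : p z := by
  let S : AddSubgroup (EnvelopingRing M) :=
    { carrier := {z | p z}, zero_mem' := h0, add_mem' := fun ha hb => hadd _ _ ha hb,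
      neg_mem' := fun ha => hneg _ ha }
  have hS : ∀ z, z ∈ S → p z := fun _ h => h
  refine hS z ?_
  induction z using TensorProduct.induction_on with
  | zero => exact S.zero_mem
  | add _ _ h₁ h₂ => exact S.add_mem h₁ h₂
  | tmul a b =>
    induction b using MulOpposite.rec' with
    | _ b =>
    induction a using MonoidAlgebra.induction_on with
    | of x =>
      induction b using MonoidAlgebra.induction_on with
      | of y => exact hof x y
      | add b c hb hc =>
        rw [MulOpposite.op_add, TensorProduct.tmul_add]
        exact S.add_mem hb hc
      | smul r b hb =>
        rw [MulOpposite.op_smul, TensorProduct.tmul_smul]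
        exact S.zsmul_mem hb r
    | add b c hb hc =>
      rw [TensorProduct.add_tmul]
      exact S.add_mem hb hc
    | smul r b hb =>
      rw [← TensorProduct.smul_tmul']
      exact S.zsmul_mem hb r

/-! ### The start of a free resolution of `ℤM` read off from the two-sided Cayley digraph. -/

variable (A : Set M)

/-- The boundary map `e_a ↦ 1 ⊗ a - a ⊗ 1` from the free bimodule on `A`. -/
noncomputable def cayleyBoundary : (A →₀ EnvelopingRing M) →ₗ[EnvelopingRing M] EnvelopingRing M :=
  Finsupp.linearCombination _ fun a : A => tmulOf 1 (a : M) - tmulOf (a : M) 1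

variable {A}

/-- Translates of the boundary of `e_a` are differences of end points of edges, so vertices in one
component agree modulo the range. By injectivity this holds for any two vertices with the same
product. -/
theorem exact_cayleyBoundary_augmentation (hA : Function.Injective (componentToMonoid A)) :
    Function.Exact (cayleyBoundary A) (augmentation M) := by
  have hedge : ∀ x y, ∀ a ∈ A,
      tmulOf x (a * y) - tmulOf (x * a) y ∈ LinearMap.range (cayleyBoundary A) := by
    intro x y a ha
    refine ⟨tmulOf x y • Finsupp.single ⟨a, ha⟩ 1, ?_⟩
    rw [map_smul, cayleyBoundary, Finsupp.linearCombination_single, one_smul, smul_eq_mul,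
      mul_sub, tmulOf_mul, tmulOf_mul, mul_one, one_mul]
  have hpath : ∀ v w : M × M, v.1 * v.2 = w.1 * w.2 →
      tmulOf v.1 v.2 - tmulOf w.1 w.2 ∈ LinearMap.range (cayleyBoundary A) := by
    intro v w h
    have h' := (component_eq_iff A).1 (hA h : component A v = component A w)
    clear h
    induction h' with
    | rel v w h =>
      obtain ⟨x, y, a, ha, rfl, rfl⟩ := h
      exact hedge x y a ha
    | refl => rw [sub_self]; exact Submodule.zero_mem _
    | symm _ _ _ ih => rw [← neg_sub]; exact Submodule.neg_mem _ ih
    | trans _ _ _ _ _ ih₁ ih₂ =>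
      rw [← sub_add_sub_cancel]
      exact Submodule.add_mem _ ih₁ ih₂
  -- Normal form modulo the range: every `x ⊗ y` may be replaced by `xy ⊗ 1`, so the class of `z`
  -- depends only on its augmentation.
  have hred : ∀ z : EnvelopingRing M, z - (augmentation M z) ⊗ₜ[ℤ] 1 ∈
      LinearMap.range (cayleyBoundary A) := by
    intro z
    induction z using EnvelopingRing.induction with
    | h0 => simp
    | hadd a b ha hb =>
      rw [map_add, TensorProduct.add_tmul, add_sub_add_comm]
      exact Submodule.add_mem _ ha hb
    | hneg a ha =>
      rw [map_neg, TensorProduct.neg_tmul, ← neg_sub']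
      exact Submodule.neg_mem _ ha
    | hof x y =>
      rw [augmentation_tmulOf]
      have := hpath (x, y) (x * y, 1) (mul_one (x * y)).symm
      rwa [tmulOf.eq_1 (x * y) 1, map_one, MulOpposite.op_one] at this
  intro z
  constructor
  · intro hz
    have := hred z
    rw [hz, TensorProduct.zero_tmul, sub_zero] at this
    exact this
  · rintro ⟨y, rfl⟩
    induction y using Finsupp.induction_linear with
    | zero => simp
    | add _ _ h₁ h₂ => rw [map_add, map_add, h₁, h₂, add_zero]
    | single a r =>
      rw [cayleyBoundary, Finsupp.linearCombination_single, map_smul, map_sub, augmentation_tmulOf,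
        augmentation_tmulOf, one_mul, mul_one, sub_self, smul_zero]

theorem isBiFP_one_of_exact {P₀ P₁ : Type u} [AddCommGroup P₀] [AddCommGroup P₁]
    [Module (EnvelopingRing M) P₀] [Module (EnvelopingRing M) P₁]
    [Module.Finite (EnvelopingRing M) P₀] [Module.Projective (EnvelopingRing M) P₀]
    [Module.Finite (EnvelopingRing M) P₁] [Module.Projective (EnvelopingRing M) P₁]
    (d : P₁ →ₗ[EnvelopingRing M] P₀) (ε : P₀ →ₗ[EnvelopingRing M] MonoidAlgebra ℤ M)
    (hε : Function.Surjective ε) (hex : Function.Exact d ε) : IsBiFP M 1 :=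
  -- For `n = 1` only degrees 0 and 1 are constrained; the sequence is continued by `P₁` with
  -- identity maps as filler.
  ⟨fun i => Nat.casesOn i P₀ fun _ => P₁,
    fun i => Nat.casesOn i ‹AddCommGroup P₀› fun _ => ‹AddCommGroup P₁›,
    fun i => Nat.casesOn i ‹Module (EnvelopingRing M) P₀› fun _ => ‹Module (EnvelopingRing M) P₁›,
    fun i => Nat.casesOn i d fun _ => LinearMap.id, ε,
    fun i _ => Nat.casesOn i ⟨‹_›, ‹_›⟩ fun _ => ⟨‹_›, ‹_›⟩, hε, fun _ => hex, fun i hi => by omega⟩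

theorem isBiFP_one_of_bijective (hfin : A.Finite)
    (hA : Function.Bijective (componentToMonoid A)) : IsBiFP M 1 := by
  have := hfin.to_subtype
  refine isBiFP_one_of_exact (cayleyBoundary A) (augmentation M) (fun z => ⟨z ⊗ₜ 1, ?_⟩)
    (exact_cayleyBoundary_augmentation hA.1)
  change (z ⊗ₜ[ℤ] 1 : EnvelopingRing M) • (1 : MonoidAlgebra ℤ M) = z
  rw [tmul_smul]
  simp

/-! ### From a bimodule resolution to a finite dominating set. -/

/-- The ring homomorphism of enveloping rings induced by `f` on the left and `g` on the right. -/
noncomputable def envelopingMap {N : Type u} [Monoid N] (f g : M →* N) :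
    EnvelopingRing M →+* EnvelopingRing N :=
  (Algebra.TensorProduct.map (MonoidAlgebra.mapDomainAlgHom ℤ ℤ f)
    (AlgHom.op (MonoidAlgebra.mapDomainAlgHom ℤ ℤ g))).toRingHom

theorem envelopingMap_tmulOf {N : Type u} [Monoid N] (f g : M →* N) (x y : M) :
    envelopingMap f g (tmulOf x y) = tmulOf (f x) (g y) := by
  simp [envelopingMap, tmulOf]

/-- An element of the enveloping ring is a finite combination of terms `x ⊗ y`. The right factors
`y` form the required set, as the left factors are sent through `f` on both sides. -/
theorem exists_finite_envelopingMap_eq (z : EnvelopingRing M) : ∃ A : Set M, A.Finite ∧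
    ∀ (N : Type u) [Monoid N] (f g : M →* N), (∀ a ∈ A, f a = g a) →
      envelopingMap f g z = envelopingMap f f z := by
  induction z using EnvelopingRing.induction with
  | h0 => exact ⟨∅, Set.finite_empty, fun N _ f g _ => by simp⟩
  | hadd a b ha hb =>
    obtain ⟨A, hA, hA'⟩ := ha
    obtain ⟨B, hB, hB'⟩ := hb
    refine ⟨A ∪ B, hA.union hB, fun N _ f g h => ?_⟩
    rw [map_add, map_add, hA' N f g fun a ha => h a (.inl ha),
      hB' N f g fun a ha => h a (.inr ha)]
  | hneg a ha =>
    obtain ⟨A, hA, hA'⟩ := ha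
    refine ⟨A, hA, fun N _ f g h => ?_⟩
    rw [map_neg, map_neg, hA' N f g h]
  | hof x y =>
    refine ⟨{y}, Set.finite_singleton y, fun N _ f g h => ?_⟩
    rw [envelopingMap_tmulOf, envelopingMap_tmulOf, h y rfl]

theorem mapDomain_smul {N : Type u} [Monoid N] (f : M →* N) (z : EnvelopingRing M)
    (x : MonoidAlgebra ℤ M) :
    MonoidAlgebra.mapDomainAlgHom ℤ ℤ f (z • x) =
      envelopingMap f f z • MonoidAlgebra.mapDomainAlgHom ℤ ℤ f x := by
  induction z using EnvelopingRing.induction with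
  | h0 =>
    have h (K : Type u) [Monoid K] (y : MonoidAlgebra ℤ K) : (0 : EnvelopingRing K) • y = 0 := by
      rw [← TensorProduct.zero_tmul _ (0 : (MonoidAlgebra ℤ K)ᵐᵒᵖ), tmul_smul, zero_mul, zero_mul]
    rw [h, map_zero, map_zero, h]
  | hadd _ _ h₁ h₂ => rw [add_smul, map_add, map_add, add_smul, h₁, h₂]
  | hneg _ h => rw [neg_smul, map_neg, map_neg, neg_smul, h]
  | hof a b =>
    rw [tmulOf, tmul_smul, map_mul, map_mul]
    exact (tmul_smul _ _ _).symm

theorem exists_finite_dominates_of_isBiFP (h : IsBiFP M 1) :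
    ∃ A : Set M, A.Finite ∧ Dominates A := by
  obtain ⟨P, _, _, d, ε, hP, hε, hex, -⟩ := h
  have hex := hex le_rfl
  obtain ⟨-, hproj⟩ := hP 0 zero_le_one
  obtain ⟨⟨T, hT⟩, -⟩ := hP 1 le_rfl
  obtain ⟨s, hs⟩ := Module.projective_def'.1 hproj
  have hs' : ∀ x, Finsupp.linearCombination (EnvelopingRing M) id (s x) = x :=
    fun x => LinearMap.congr_fun hs x
  obtain ⟨x₁, hx₁⟩ := hε 1
  choose B hB hB' using exists_finite_envelopingMap_eq (M := M)
  -- The finitely many elements on which the twisted map must agree with `F ∘ ε`: a lift of `1` and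
  -- generators of `ker ε`.
  let V : Set (P 0) := insert x₁ (d 0 '' (T : Set (P 1)))
  have hV : V.Finite := (T.finite_toSet.image _).insert _
  refine ⟨⋃ x ∈ V, ⋃ y ∈ (s x).support, B (s x y),
    hV.biUnion fun x _ => (s x).support.finite_toSet.biUnion fun y _ => hB _, ?_⟩
  intro N _ f g hfg
  let F := MonoidAlgebra.mapDomainAlgHom ℤ ℤ f
  -- `ℤN` is twisted: `M` acts on the left through `f` and on the right through `g`. `F ∘ ε` need
  -- not be linear for this structure, but `Θ` is.
  let : Module (EnvelopingRing M) (MonoidAlgebra ℤ N) :=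
    Module.compHom _ (envelopingMap f g)
  let Θ : P 0 →ₗ[EnvelopingRing M] MonoidAlgebra ℤ N :=
    Finsupp.linearCombination (EnvelopingRing M) (fun x => F (ε x)) ∘ₗ s
  have hΘ : ∀ x ∈ V, Θ x = F (ε x) := by
    intro x hx
    have h₁ : Θ x = ∑ y ∈ (s x).support, envelopingMap f g (s x y) • F (ε y) := rfl
    have h₂ : x = ∑ y ∈ (s x).support, s x y • y := (hs' x).symm
    rw [h₁]
    conv_rhs => rw [h₂]
    rw [map_sum, map_sum]
    refine Finset.sum_congr rfl fun y hy => ?_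
    rw [map_smul, mapDomain_smul, hB' (s x y) N f g]
    intro a ha
    exact hfg a (Set.mem_biUnion hx (Set.mem_biUnion (Finset.mem_coe.2 hy) ha))
  have hker : ∀ z, ε z = 0 → Θ z = 0 := by
    intro z hz
    obtain ⟨y, rfl⟩ := (hex z).1 hz
    have : Θ ∘ₗ d 0 = 0 := by
      refine LinearMap.ext_on hT fun t ht => ?_
      rw [LinearMap.comp_apply, hΘ _ (Or.inr ⟨t, ht, rfl⟩), (hex _).2 ⟨t, rfl⟩, map_zero]
      rfl
    exact LinearMap.congr_fun this y
  have hx₁' : Θ x₁ = 1 := by rw [hΘ _ (Or.inl rfl), hx₁, map_one]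
  ext m
  -- Left and right translation of `x₁` by `m` both lie over `m`. Their images under `Θ` are `f m`
  -- and `g m`.
  have h₀ : Θ (tmulOf m 1 • x₁ - tmulOf 1 m • x₁) = 0 := by
    refine hker _ ?_
    rw [map_sub, map_smul, map_smul, hx₁, ← map_one (MonoidAlgebra.of ℤ M), tmulOf_smul,
      tmulOf_smul, mul_one, mul_one, one_mul, one_mul, sub_self]
  rw [map_sub, map_smul, map_smul, hx₁', sub_eq_zero] at h₀
  have h₁ : envelopingMap f g (tmulOf m 1) • (1 : MonoidAlgebra ℤ N) =
    envelopingMap f g (tmulOf 1 m) • (1 : MonoidAlgebra ℤ N) := h₀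
  rw [envelopingMap_tmulOf, envelopingMap_tmulOf, ← map_one (MonoidAlgebra.of ℤ N), tmulOf_smul,
    tmulOf_smul, map_one, map_one, mul_one, mul_one, one_mul, one_mul] at h₁
  exact MonoidAlgebra.of_injective h₁

end Bimodules

/-! ### Free sets with an action -/

/-- The free `G`-set on a type `T`. -/
def FreeSet (G T : Type u) : Type u := G × T

instance (G T : Type u) [Monoid G] : MulAction G (FreeSet G T) where
  smul g x := (g * x.1, x.2)
  one_smul _ := Prod.ext (one_mul _) rfl
  mul_smul _ _ _ := Prod.ext (mul_assoc _ _ _) rfl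

/-- The equivariant map from the free `G`-set on the underlying set of `P` onto `P`. -/
def freeCover (G P : Type u) [Monoid G] [MulAction G P] : FreeSet G P →[G] P where
  toFun x := x.1 • x.2
  map_smul' _ _ := mul_smul _ _ _

theorem zerothHomotopy_mk_eq_mk {X : Type u} [TopologicalSpace X] {x y : X} :
    ZerothHomotopy.mk x = ZerothHomotopy.mk y ↔ Joined x y :=
  ⟨fun h => Quotient.exact h, fun h => Quotient.sound h⟩

/-! ### Cell-by-cell extension of maps -/

section CW

theorem skeletonLT_mono {X : Type u} {cell : ℕ → Type u} (char : (n : ℕ) → cell n → UnitBall n → X)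
    {m n : ℕ} (h : m ≤ n) : skeletonLT char m ⊆ skeletonLT char n :=
  fun _ ⟨k, hk, c, b, hx⟩ => ⟨k, hk.trans_le h, c, b, hx⟩

theorem mem_skeletonLT_succ {X : Type u} {cell : ℕ → Type u}
    {char : (n : ℕ) → cell n → UnitBall n → X} {n : ℕ} {x : X} :
    x ∈ skeletonLT char (n + 1) ↔ x ∈ skeletonLT char n ∨ ∃ c b, char n c b = x := by
  constructor
  · rintro ⟨k, hk, c, b, rfl⟩
    rcases Nat.lt_succ_iff_lt_or_eq.1 hk with hk | rfl
    · exact .inl ⟨k, hk, c, b, rfl⟩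
    · exact .inr ⟨c, b, rfl⟩
  · rintro (h | ⟨c, b, rfl⟩)
    · exact skeletonLT_mono char n.le_succ h
    · exact ⟨n, n.lt_succ_self, c, b, rfl⟩

theorem UnitBall.norm_le {n : ℕ} (b : UnitBall n) : ‖b.1‖ ≤ 1 :=
  mem_closedBall_zero_iff.1 b.2

theorem UnitBall.norm_lt_or_eq {n : ℕ} (b : UnitBall n) : ‖b.1‖ < 1 ∨ ‖b.1‖ = 1 :=
  b.norm_le.lt_or_eq

theorem UnitBall.norm_lt_of_zero (b : UnitBall 0) : ‖b.1‖ < 1 := by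
  rw [Subsingleton.elim b.1 0, norm_zero]
  exact one_pos

/-- The centre of the unit ball. -/
def UnitBall.center (n : ℕ) : UnitBall n := ⟨0, by simp⟩

theorem UnitBall.eq_center (b : UnitBall 0) : b = UnitBall.center 0 :=
  Subtype.ext (Subsingleton.elim _ _)

instance (n : ℕ) : PathConnectedSpace (UnitBall n) :=
  isPathConnected_iff_pathConnectedSpace.1
    ((convex_closedBall _ _).isPathConnected ⟨0, by simp⟩)

theorem UnitBall.exists_norm_eq_one (n : ℕ) : ∃ b : UnitBall (n + 1), ‖b.1‖ = 1 :=
  ⟨⟨EuclideanSpace.single 0 1, by simp⟩, by simp⟩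

theorem UnitBall.isPreconnected_sphere (n : ℕ) :
    IsPreconnected {b : UnitBall (n + 2) | ‖b.1‖ = 1} := by
  have h : IsPreconnected (Metric.sphere (0 : EuclideanSpace ℝ (Fin (n + 2))) 1) := by
    refine _root_.isPreconnected_sphere ?_ _ _
    refine Module.lt_rank_of_lt_finrank ?_
    simp
  refine (Topology.IsInducing.subtypeVal.isPreconnected_image).1 ?_
  convert h
  ext x
  constructor
  · rintro ⟨b, hb, rfl⟩
    simpa using hb
  · intro hx
    have hx : ‖x‖ = 1 := by simpa using hx
    exact ⟨⟨x, by simp [hx]⟩, hx, rfl⟩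

theorem UnitBall.finite_sphere_one : {b : UnitBall 1 | ‖b.1‖ = 1}.Finite := by
  refine Set.Finite.of_finite_image (f := fun b => b.1 0)
    ((Set.toFinite {(1 : ℝ), -1}).subset ?_) ?_
  · rintro _ ⟨b, hb, rfl⟩
    have hb : ‖b.1‖ = 1 := hb
    rw [EuclideanSpace.norm_eq] at hb
    simpa using hb
  · intro b _ b' _ h
    refine Subtype.ext (PiLp.ext fun i => ?_)
    rw [Subsingleton.elim i 0]
    exact h

variable {G X Y : Type u} [Monoid G] [TopologicalSpace X] [MulAction G X]
  [TopologicalSpace Y] (S : ProjectiveCWStructure G X)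

/-- This is the universal property of the pushout, for functions defined on all of `X` whose
continuity is only controlled on a skeleton. -/
theorem ProjectiveCWStructure.exists_extension_succ {n : ℕ} {r : X → Y}
    (hr : ContinuousOn r (skeletonLT S.char n)) (u : S.cell n → UnitBall n → Y)
    (hu : ∀ c, Continuous (u c)) (hur : ∀ c b, ‖b.1‖ = 1 → u c b = r (S.char n c b)) :
    ∃ r' : X → Y, ContinuousOn r' (skeletonLT S.char (n + 1)) ∧
      (∀ x ∈ skeletonLT S.char n, r' x = r x) ∧ ∀ c b, r' (S.char n c b) = u c b := by
  classical
  -- Only open cells are redefined, where the coordinates are unique by `char_injOn`; on boundary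
  -- spheres `r` already agrees with `u`.
  let r' : X → Y := fun x => if h : ∃ p : S.cell n × UnitBall n, ‖p.2.1‖ < 1 ∧
    S.char n p.1 p.2 = x then u h.choose.1 h.choose.2 else r x
  have h₁ : ∀ x ∈ skeletonLT S.char n, r' x = r x := by
    intro x hx
    refine dif_neg ?_
    rintro ⟨p, hp, rfl⟩
    exact S.char_ball n _ _ hp hx
  have h₂ : ∀ c b, r' (S.char n c b) = u c b := by
    intro c b
    rcases b.norm_lt_or_eq with hb | hb
    · have h : ∃ p : S.cell n × UnitBall n, ‖p.2.1‖ < 1 ∧ S.char n p.1 p.2 = S.char n c b :=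
        ⟨(c, b), hb, rfl⟩
      have e := S.char_injOn n _ _ _ _ h.choose_spec.1 hb h.choose_spec.2
      exact (dif_pos h).trans (by rw [e.1, e.2])
    · rw [h₁ _ (S.char_sphere n c b hb), hur c b hb]
  refine ⟨r', ?_, h₁, h₂⟩
  refine continuousOn_iff_isClosed.2 fun D hD => ⟨r' ⁻¹' D ∩ skeletonLT S.char (n + 1), ?_, ?_⟩
  · refine S.isClosed_of_pushout n _ Set.inter_subset_right ?_ fun c => ?_
    · have : r' ⁻¹' D ∩ skeletonLT S.char (n + 1) ∩ skeletonLT S.char n =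
          skeletonLT S.char n ∩ r ⁻¹' D := by
        ext x
        constructor
        · rintro ⟨⟨hx, -⟩, hx'⟩
          exact ⟨hx', by rwa [Set.mem_preimage, ← h₁ x hx']⟩
        · rintro ⟨hx, hx'⟩
          exact ⟨⟨by rwa [Set.mem_preimage, h₁ x hx], skeletonLT_mono _ n.le_succ hx⟩, hx⟩
      rw [this]
      exact hr.preimage_isClosed_of_isClosed (S.isClosed_skeletonLT n) hD
    · convert hD.preimage (hu c) using 1
      ext b
      simp only [Set.mem_preimage, Set.mem_inter_iff, h₂]
      exact and_iff_left (mem_skeletonLT_succ.2 (.inr ⟨c, b, rfl⟩))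
  · rw [Set.inter_assoc, Set.inter_self]

/-- A continuous map with prescribed properties on the cells of a CW complex can be constructed
cell by cell. -/
theorem ProjectiveCWStructure.exists_continuous [Nonempty Y]
    (Q : ∀ n, S.cell n → (UnitBall n → Y) → Prop)
    (hQ : ∀ n (c : S.cell n) (r : X → Y), ContinuousOn r (skeletonLT S.char n) →
      (∀ k < n, ∀ c', Q k c' (r ∘ S.char k c')) →
      ∃ u, Continuous u ∧ (∀ b, ‖b.1‖ = 1 → u b = r (S.char n c b)) ∧ Q n c u) :
    ∃ R : X → Y, Continuous R ∧ ∀ n c, Q n c (R ∘ S.char n c) := by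
  let E : ℕ → Type u := fun n => {r : X → Y // ContinuousOn r (skeletonLT S.char n) ∧
    ∀ k < n, ∀ c, Q k c (r ∘ S.char k c)}
  have step : ∀ n (r : E n), ∃ r' : E (n + 1), ∀ x ∈ skeletonLT S.char n, r'.1 x = r.1 x := by
    rintro n ⟨r, hr, hr'⟩
    choose u hu hur huQ using fun c => hQ n c r hr hr'
    obtain ⟨r', h₁, h₂, h₃⟩ := S.exists_extension_succ hr u hu hur
    refine ⟨⟨r', h₁, fun k hk c => ?_⟩, h₂⟩
    rcases Nat.lt_succ_iff_lt_or_eq.1 hk with hk | rfl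
    · convert hr' k hk c using 1
      exact funext fun b => h₂ _ ⟨k, hk, c, b, rfl⟩
    · convert huQ c using 1
      exact funext fun b => h₃ c b
  choose F hF using step
  have e₀ : skeletonLT S.char 0 = ∅ := Set.eq_empty_of_forall_notMem fun _ ⟨_, h, _⟩ =>
    Nat.not_lt_zero _ h
  let r : ∀ n, E n := fun n => Nat.rec ⟨fun _ => Classical.arbitrary Y,
    by rw [e₀]; exact continuousOn_empty _, fun k hk => absurd hk (Nat.not_lt_zero k)⟩ F n
  have hr : ∀ m n, m ≤ n → ∀ x ∈ skeletonLT S.char m, (r n).1 x = (r m).1 x := by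
    intro m n hmn x hx
    induction n, hmn using Nat.le_induction with
    | base => rfl
    | succ n hmn ih => rw [← ih, ← hF n (r n) x (skeletonLT_mono _ hmn hx)]
  choose ν hν using S.exists_mem_skeletonLT
  -- The glued map may be computed at any stage whose skeleton contains `x`, not just at the chosen
  -- `ν x`.
  have hR : ∀ n, ∀ x ∈ skeletonLT S.char n, (r (ν x)).1 x = (r n).1 x := by
    intro n x hx
    rcases le_total n (ν x) with h | h
    · exact hr _ _ h x hx
    · exact (hr _ _ h x (hν x)).symm
  refine ⟨fun x => (r (ν x)).1 x, continuous_iff_isClosed.2 fun D hD => ?_, fun n c => ?_⟩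
  · refine S.isClosed_of_colimit _ fun n => ?_
    convert (r n).2.1.preimage_isClosed_of_isClosed (S.isClosed_skeletonLT n) hD using 1
    ext x
    constructor
    · rintro ⟨hx, hx'⟩
      exact ⟨hx', by rwa [Set.mem_preimage, ← hR n x hx']⟩
    · rintro ⟨hx, hx'⟩
      exact ⟨by rwa [Set.mem_preimage, hR n x hx], hx⟩
  · convert (r (n + 1)).2.2 n n.lt_succ_self c using 1
    exact funext fun b => hR (n + 1) _ (mem_skeletonLT_succ.2 (.inr ⟨c, b, rfl⟩))

theorem ProjectiveCWStructure.joined_char {n : ℕ} (c : S.cell n) (b b' : UnitBall n) :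
    Joined (S.char n c b) (S.char n c b') :=
  (PathConnectedSpace.joined b b').map (S.continuous_char n c)

theorem ProjectiveCWStructure.exists_vertex_of_mem_skeletonLT_one {x : X}
    (hx : x ∈ skeletonLT S.char 1) : ∃ v, S.char 0 v (UnitBall.center 0) = x := by
  obtain ⟨k, hk, c, b, rfl⟩ := hx
  obtain rfl : k = 0 := by omega
  exact ⟨c, by rw [b.eq_center]⟩

/-- A cell of positive dimension is path connected and has nonempty boundary, so a point can be
moved into a lower skeleton. -/
theorem ProjectiveCWStructure.exists_vertex_joined (x : X) :
    ∃ v, Joined (S.char 0 v (UnitBall.center 0)) x := by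
  obtain ⟨n, hx⟩ := S.exists_mem_skeletonLT x
  induction n using Nat.strong_induction_on generalizing x with
  | _ n ih =>
    obtain ⟨k, hk, c, b, rfl⟩ := hx
    cases k with
    | zero => exact ⟨c, by rw [b.eq_center]⟩
    | succ k =>
      obtain ⟨b', hb'⟩ := UnitBall.exists_norm_eq_one k
      obtain ⟨v, hv⟩ := ih (k + 1) hk _ (S.char_sphere _ c b' hb')
      exact ⟨v, hv.trans (S.joined_char c b' b)⟩

theorem ProjectiveCWStructure.vertex_injective {v w : S.cell 0}
    (h : S.char 0 v (UnitBall.center 0) = S.char 0 w (UnitBall.center 0)) : v = w :=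
  (S.char_injOn 0 v w _ _ (UnitBall.norm_lt_of_zero _) (UnitBall.norm_lt_of_zero _) h).1

/-- A function on vertices which agrees on the end points of every edge is invariant under
paths. -/
theorem ProjectiveCWStructure.eq_of_joined {N : Type u} (θ : S.cell 0 → N)
    (hθ : ∀ (c : S.cell 1) (b b' : UnitBall 1) (v w : S.cell 0), ‖b.1‖ = 1 → ‖b'.1‖ = 1 →
      S.char 0 v (UnitBall.center 0) = S.char 1 c b →
      S.char 0 w (UnitBall.center 0) = S.char 1 c b' → θ v = θ w)
    {v w : S.cell 0}
    (h : Joined (S.char 0 v (UnitBall.center 0)) (S.char 0 w (UnitBall.center 0))) :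
    θ v = θ w := by
  -- With `N` discrete, `θ` is extended to a continuous map on all of `X`; such a map is constant
  -- along any path, however many cells the path meets.
  let _ : TopologicalSpace N := ⊥
  have : DiscreteTopology N := ⟨rfl⟩
  have : Nonempty N := ⟨θ v⟩
  let Q : ∀ n, S.cell n → (UnitBall n → N) → Prop := fun n => match n with
    | 0 => fun c u => ∀ b, u b = θ c
    | _ + 1 => fun _ _ => True
  obtain ⟨R, hR, hRQ⟩ := S.exists_continuous Q (by
    intro n c r hr hrQ
    -- A map that is constant on the boundary sphere extends as a constant. Constancy comes from
    -- `hθ` on edges and from connectedness of the sphere in dimension at least two.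
    have huniq : (∀ b b' : UnitBall n, ‖b.1‖ = 1 → ‖b'.1‖ = 1 →
        r (S.char n c b) = r (S.char n c b')) → ∃ u : UnitBall n → N, Continuous u ∧
          ∀ b, ‖b.1‖ = 1 → u b = r (S.char n c b) := by
      intro hc
      by_cases hne : ∃ b : UnitBall n, ‖b.1‖ = 1
      · obtain ⟨b, hb⟩ := hne
        exact ⟨fun _ => r (S.char n c b), continuous_const, fun b' hb' => hc b b' hb hb'⟩
      · exact ⟨fun _ => Classical.arbitrary N, continuous_const, fun b hb => absurd ⟨b, hb⟩ hne⟩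
    match n, c, hr, hrQ, huniq with
    | 0, c, _, _, _ =>
      exact ⟨fun _ => θ c, continuous_const, fun b hb => absurd hb b.norm_lt_of_zero.ne,
        fun _ => rfl⟩
    | 1, c, hr, hrQ, huniq =>
      obtain ⟨u, hu, hu'⟩ := huniq (by
        intro b b' hb hb'
        obtain ⟨v, hv⟩ := S.exists_vertex_of_mem_skeletonLT_one (S.char_sphere 1 c b hb)
        obtain ⟨w, hw⟩ := S.exists_vertex_of_mem_skeletonLT_one (S.char_sphere 1 c b' hb')
        have h₁ := hrQ 0 one_pos v (UnitBall.center 0)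
        have h₂ := hrQ 0 one_pos w (UnitBall.center 0)
        rw [Function.comp_apply] at h₁ h₂
        rw [← hv, ← hw, h₁, h₂]
        exact hθ c b b' v w hb hb' hv hw)
      exact ⟨u, hu, hu', trivial⟩
    | n + 2, c, hr, hrQ, huniq =>
      obtain ⟨u, hu, hu'⟩ := huniq (by
        intro b b' hb hb'
        refine (UnitBall.isPreconnected_sphere n).constant (f := fun b => r (S.char (n + 2) c b))
          ?_ hb hb'
        exact hr.comp (S.continuous_char _ c).continuousOn fun b hb => S.char_sphere _ c b hb)
      exact ⟨u, hu, hu', trivial⟩)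
  have hv : R (S.char 0 v (UnitBall.center 0)) = θ v := hRQ 0 v _
  have hw : R (S.char 0 w (UnitBall.center 0)) = θ w := hRQ 0 w _
  rw [← hv, ← hw]
  obtain ⟨γ⟩ := h
  have := PreconnectedSpace.constant (Y := N) inferInstance (f := R ∘ γ) (hR.comp γ.continuous)
    (x := 0) (y := 1)
  simpa using this

end CW

/-! ### Domination from a classifying space -/

/-- This is the set-level analogue of `exists_finite_dominates_of_isBiFP`: vertices replace `P 0`
and edges replace `P 1`. -/
theorem exists_finite_dominates_of_isBiF {M : Type u} [Monoid M] (h : IsBiF M 1) :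
    ∃ A : Set M, A.Finite ∧ Dominates A := by
  obtain ⟨X, _, _, _, S, ⟨⟨φ₀, hφ₀⟩, -⟩, hfg⟩ := h
  obtain ⟨T, hT, hTgen⟩ := hfg 1 le_rfl
  let vert : S.cell 0 → X := fun v => S.char 0 v (UnitBall.center 0)
  have hvert : ∀ (g : M × Mᵐᵒᵖ) v, vert (g • v) = g • vert v := fun g v => S.char_smul 0 g v _
  let φ : S.cell 0 → M := fun v => φ₀ (ZerothHomotopy.mk (vert v))
  have hφ : ∀ (g : M × Mᵐᵒᵖ) v, φ (g • v) = g.1 * φ v * g.2.unop := by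
    intro g v
    change φ₀ (ZerothHomotopy.mk (vert (g • v))) = _
    rw [hvert, hφ₀]
  obtain ⟨s, hs⟩ := S.projective 0 _ (freeCover (M × Mᵐᵒᵖ) (S.cell 0)) fun v =>
    ⟨(1, v), one_smul _ v⟩
  obtain ⟨v₁, hv₁⟩ : ∃ v, φ v = 1 := by
    obtain ⟨x, hx⟩ := ZerothHomotopy.mk_surjective (φ₀.symm 1)
    obtain ⟨v, hv⟩ := S.exists_vertex_joined x
    refine ⟨v, ?_⟩
    change φ₀ (ZerothHomotopy.mk (vert v)) = 1
    rw [zerothHomotopy_mk_eq_mk.2 hv, hx, φ₀.apply_symm_apply]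
  let V : Set (S.cell 0) := insert v₁ {v | ∃ c ∈ T, ∃ b : UnitBall 1, ‖b.1‖ = 1 ∧
    vert v = S.char 1 c b}
  have hV : V.Finite := by
    -- There are finitely many generating edges, `S⁰` is finite, and each point of `X` is at most
    -- one vertex.
    refine Set.Finite.insert _ (Set.Finite.subset (hT.biUnion fun c _ =>
      UnitBall.finite_sphere_one.biUnion fun b _ => Set.Subsingleton.finite
        (s := {v | vert v = S.char 1 c b}) fun v hv w hw => S.vertex_injective (hv.trans hw.symm))
      ?_)
    rintro v ⟨c, hc, b, hb, h⟩
    exact Set.mem_biUnion hc (Set.mem_biUnion hb h)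
  refine ⟨(fun v => (s v).1.2.unop) '' V, hV.image _, fun N _ f h hfh => ?_⟩
  -- The section writes `v` as a translate of `(s v).2`. Replacing `f` by `h` on the right
  -- coordinate alone gives a map equivariant for the twisted action.
  let θ : S.cell 0 → N := fun v => f (s v).1.1 * f (φ (s v).2) * h (s v).1.2.unop
  have hθ : ∀ (g : M × Mᵐᵒᵖ) v, θ (g • v) = f g.1 * θ v * h g.2.unop := by
    intro g v
    have : s (g • v) = (g * (s v).1, (s v).2) := map_smul s g v
    simp only [θ, this, Prod.fst_mul, Prod.snd_mul, MulOpposite.unop_mul, map_mul, mul_assoc]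
  have hθV : ∀ v ∈ V, θ v = f (φ v) := by
    intro v hv
    have h₁ : (s v).1 • (s v).2 = v := hs v
    conv_rhs => rw [← h₁, hφ]
    simp only [θ, map_mul]
    rw [hfh _ ⟨v, hv, rfl⟩]
  have key : ∀ v w, φ v = φ w → θ v = θ w := by
    intro v w hvw
    refine S.eq_of_joined θ ?_ (zerothHomotopy_mk_eq_mk.1 (φ₀.injective hvw))
    -- The right-hand side does not involve `b`: an end point of a translated generating edge gets a
    -- value depending only on the translation and on the component of the generator.
    have hend : ∀ c ∈ T, ∀ (g : M × Mᵐᵒᵖ) (b : UnitBall 1) (v : S.cell 0), ‖b.1‖ = 1 →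
        vert v = S.char 1 (g • c) b →
        θ v = f g.1 * f (φ₀ (ZerothHomotopy.mk (S.char 1 c (UnitBall.center 1)))) *
          h g.2.unop := by
      intro c hc g b v hb hv
      obtain ⟨v', hv'⟩ := S.exists_vertex_of_mem_skeletonLT_one (S.char_sphere 1 c b hb)
      have : v = g • v' := by
        refine S.vertex_injective (hv.trans ?_)
        rw [S.char_smul, ← hv']
        exact (hvert g v').symm
      rw [this, hθ, hθV v' (.inr ⟨c, hc, b, hb, hv'⟩),
        ← zerothHomotopy_mk_eq_mk.2 (S.joined_char c b _), ← hv']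
    intro c b b' v w hb hb' hv hw
    obtain ⟨c₀, hc₀, g, rfl⟩ := hTgen c
    rw [hend c₀ hc₀ g b v hb hv, hend c₀ hc₀ g b' w hb' hw]
  have hθ₁ : θ v₁ = 1 := by rw [hθV v₁ (.inl rfl), hv₁, map_one]
  ext m
  have := key (((m, 1) : M × Mᵐᵒᵖ) • v₁) (((1, MulOpposite.op m) : M × Mᵐᵒᵖ) • v₁)
    (by rw [hφ, hφ, hv₁]; simp)
  rw [hθ, hθ, hθ₁] at this
  simpa using this

/-! ### Free sets as index sets of cells, and the decomposition of a ball into interior and sphere.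
-/

theorem FreeSet.isProjectiveSet (G T : Type u) [Monoid G] : IsProjectiveSet G (FreeSet G T) := by
  intro Y _ f hf
  choose s hs using hf
  refine ⟨⟨fun x => x.1 • s (1, x.2), fun g x => mul_smul g x.1 _⟩, fun x => ?_⟩
  exact (map_smul f _ _).trans ((congrArg (x.1 • ·) (hs (1, x.2))).trans
    (Prod.ext (mul_one x.1) rfl))

theorem FreeSet.isFGSet (G T : Type u) [Monoid G] [Finite T] : IsFGSet G (FreeSet G T) :=
  ⟨Set.range fun t => ((1, t) : G × T), Set.finite_range _, fun x =>
    ⟨(1, x.2), ⟨x.2, rfl⟩, x.1, Prod.ext (mul_one x.1) rfl⟩⟩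

/-- The boundary sphere of the unit ball. -/
abbrev UnitSphere (n : ℕ) : Type := {b : UnitBall n // ‖b.1‖ = 1}

/-- The interior of the unit ball. -/
abbrev OpenBall (n : ℕ) : Type := {b : UnitBall n // ‖b.1‖ < 1}

/-! ### Attaching free cells -/

/-- A `G`-space over the `G`-set `Q` with a base point over `q`. -/
structure Stage (G Q : Type u) [Monoid G] [MulAction G Q] (q : Q) where
  /-- The underlying space. -/
  carrier : Type u
  /-- The topology. -/
  [top : TopologicalSpace carrier]
  /-- The action. -/
  [act : MulAction G carrier]
  /-- The action is continuous. -/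
  [cont : ContinuousConstSMul G carrier]
  /-- The projection to `Q`. -/
  proj : carrier → Q
  /-- The projection is continuous. -/
  isLocallyConstant_proj : IsLocallyConstant proj
  /-- The projection is equivariant. -/
  proj_smul : ∀ (g : G) x, proj (g • x) = g • proj x
  /-- The base point. -/
  base : carrier
  /-- The base point lies over `q`. -/
  proj_base : proj base = q

attribute [instance] Stage.top Stage.act Stage.cont

variable {G Q : Type u} [Monoid G] [MulAction G Q] {q : Q}

/-- Attaching maps for a family of free cells of dimension `n`. -/
structure AttachData (S : Stage G Q q) (n : ℕ) where
  /-- The index set of generating cells. -/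
  index : Type u
  /-- The attaching maps. -/
  map : index → C(UnitSphere n, S.carrier)
  /-- The element of `Q` under a cell. -/
  val : index → Q
  /-- The attaching map of a cell lies over a single element of `Q`. -/
  proj_map : ∀ t b, S.proj (map t b) = val t

namespace AttachData

variable {S : Stage G Q q} {n : ℕ} (D : AttachData S n)

/-- The result of attaching free cells. -/
def Space : Type u := S.carrier ⊕ FreeSet G D.index × OpenBall n

/-- The inclusion of the old space. -/
def incl (x : S.carrier) : D.Space := Sum.inl x

/-- The open cells. -/
def openCell (c : FreeSet G D.index) (b : OpenBall n) : D.Space := Sum.inr (c, b)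

open Classical in
/-- The characteristic map of a cell. -/
noncomputable def char (c : FreeSet G D.index) (b : UnitBall n) : D.Space :=
  if h : ‖b.1‖ < 1 then D.openCell c ⟨b, h⟩
  else D.incl (c.1 • D.map c.2 ⟨b, b.norm_lt_or_eq.resolve_left h⟩)

theorem char_of_lt (c : FreeSet G D.index) {b : UnitBall n} (h : ‖b.1‖ < 1) :
    D.char c b = D.openCell c ⟨b, h⟩ := dif_pos h

theorem char_of_eq (c : FreeSet G D.index) {b : UnitBall n} (h : ‖b.1‖ = 1) :
    D.char c b = D.incl (c.1 • D.map c.2 ⟨b, h⟩) := dif_neg h.not_lt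

theorem incl_injective : Function.Injective D.incl := Sum.inl_injective

theorem incl_or_openCell (x : D.Space) : (∃ y, x = D.incl y) ∨ ∃ c b, x = D.openCell c b :=
  match x with
  | Sum.inl y => .inl ⟨y, rfl⟩
  | Sum.inr y => .inr ⟨y.1, y.2, rfl⟩

noncomputable instance : TopologicalSpace D.Space :=
  TopologicalSpace.coinduced D.incl inferInstance ⊔
    ⨆ c, TopologicalSpace.coinduced (D.char c) inferInstance

theorem isOpen_iff {s : Set D.Space} :
    IsOpen s ↔ IsOpen (D.incl ⁻¹' s) ∧ ∀ c, IsOpen (D.char c ⁻¹' s) := by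
  refine isOpen_sup.trans (and_congr isOpen_coinduced (isOpen_iSup_iff.trans ?_))
  exact forall_congr' fun c => isOpen_coinduced

theorem isClosed_iff {s : Set D.Space} :
    IsClosed s ↔ IsClosed (D.incl ⁻¹' s) ∧ ∀ c, IsClosed (D.char c ⁻¹' s) := by
  simp only [← isOpen_compl_iff, isOpen_iff, Set.preimage_compl]

theorem continuous_incl : Continuous D.incl :=
  continuous_def.2 fun _ hs => (D.isOpen_iff.1 hs).1

theorem continuous_char (c : FreeSet G D.index) : Continuous (D.char c) :=
  continuous_def.2 fun _ hs => (D.isOpen_iff.1 hs).2 c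

theorem continuous_of {Y : Type*} [TopologicalSpace Y] {f : D.Space → Y}
    (h : Continuous (f ∘ D.incl)) (h' : ∀ c, Continuous (f ∘ D.char c)) : Continuous f :=
  continuous_def.2 fun _ hs => D.isOpen_iff.2 ⟨hs.preimage h, fun c => hs.preimage (h' c)⟩

/-- In each cell the image is met only on the boundary sphere, in a closed subset of it, and the
sphere is closed in the ball. -/
theorem isClosed_image_incl {s : Set S.carrier} (hs : IsClosed s) : IsClosed (D.incl '' s) := by
  refine D.isClosed_iff.2 ⟨by rwa [Set.preimage_image_eq _ D.incl_injective], fun c => ?_⟩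
  have hsph : IsClosed {b : UnitBall n | ‖b.1‖ = 1} :=
    isClosed_eq (continuous_norm.comp continuous_subtype_val) continuous_const
  have : D.char c ⁻¹' (D.incl '' s) =
      Subtype.val '' {b : UnitSphere n | c.1 • D.map c.2 b ∈ s} := by
    ext b
    constructor
    · rintro ⟨x, hx, h⟩
      rcases b.norm_lt_or_eq with hb | hb
      · rw [D.char_of_lt c hb] at h
        cases h
      · rw [D.char_of_eq c hb] at h
        exact ⟨⟨b, hb⟩, by rwa [Set.mem_ofPred_eq, ← D.incl_injective h], rfl⟩
    · rintro ⟨b, hb, rfl⟩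
      exact ⟨_, hb, (D.char_of_eq c b.2).symm⟩
  rw [this]
  refine hsph.isClosedEmbedding_subtypeVal.isClosedMap _ ?_
  exact hs.preimage ((D.map c.2).continuous.const_smul c.1)

instance : MulAction G D.Space where
  smul g x := match x with
    | Sum.inl x => Sum.inl (g • x)
    | Sum.inr (c, b) => Sum.inr (g • c, b)
  one_smul x := match x with
    | Sum.inl x => congrArg Sum.inl (one_smul G x)
    | Sum.inr (c, b) => congrArg (fun c => Sum.inr (c, b)) (one_smul G c)
  mul_smul g h x := match x with
    | Sum.inl x => congrArg Sum.inl (mul_smul g h x)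
    | Sum.inr (c, b) =>
      congrArg (fun c => (Sum.inr (c, b) : S.carrier ⊕ FreeSet G D.index × OpenBall n))
        (mul_smul g h c)

theorem smul_incl (g : G) (x : S.carrier) : g • D.incl x = D.incl (g • x) := rfl

theorem smul_openCell (g : G) (c : FreeSet G D.index) (b : OpenBall n) :
    g • D.openCell c b = D.openCell (g • c) b := rfl

theorem smul_char (g : G) (c : FreeSet G D.index) (b : UnitBall n) :
    g • D.char c b = D.char (g • c) b := by
  rcases b.norm_lt_or_eq with hb | hb
  · rw [D.char_of_lt _ hb, D.char_of_lt _ hb, smul_openCell]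
  · rw [D.char_of_eq _ hb, D.char_of_eq _ hb, smul_incl]
    exact congrArg D.incl (mul_smul _ _ _).symm

instance : ContinuousConstSMul G D.Space where
  continuous_const_smul g := by
    refine D.continuous_of (D.continuous_incl.comp (continuous_const_smul g)) fun c => ?_
    convert D.continuous_char (g • c) using 1
    exact funext fun b => D.smul_char g c b

/-- The projection to `Q`. -/
def proj (x : D.Space) : Q := Sum.elim S.proj (fun y => y.1.1 • D.val y.1.2) x

theorem proj_incl (x : S.carrier) : D.proj (D.incl x) = S.proj x := rfl

theorem proj_openCell (c : FreeSet G D.index) (b : OpenBall n) :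
    D.proj (D.openCell c b) = c.1 • D.val c.2 := rfl

theorem proj_char (c : FreeSet G D.index) (b : UnitBall n) :
    D.proj (D.char c b) = c.1 • D.val c.2 := by
  rcases b.norm_lt_or_eq with hb | hb
  · rw [D.char_of_lt _ hb, proj_openCell]
  · rw [D.char_of_eq _ hb, proj_incl, S.proj_smul, D.proj_map]

/-- The stage obtained by attaching free cells. -/
noncomputable def attach : Stage G Q q where
  carrier := D.Space
  proj := D.proj
  isLocallyConstant_proj s := by
    refine D.isOpen_iff.2 ⟨S.isLocallyConstant_proj s, fun c => ?_⟩
    have : D.char c ⁻¹' (D.proj ⁻¹' s) = {_b | c.1 • D.val c.2 ∈ s} := by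
      ext b
      rw [Set.mem_preimage, Set.mem_preimage, proj_char, Set.mem_ofPred_eq]
    rw [this]
    exact isOpen_const
  proj_smul g x := by
    rcases D.incl_or_openCell x with ⟨y, rfl⟩ | ⟨c, b, rfl⟩
    · exact S.proj_smul g y
    · exact mul_smul _ _ _
  base := D.incl S.base
  proj_base := S.proj_base

end AttachData

/-! ### The colimit of a sequence of attachments -/

/-- The free `G`-set on one point, over `Q` by the orbit map of `q`. -/
def vertexStage (G : Type u) {Q : Type u} [Monoid G] [MulAction G Q] (q : Q) : Stage G Q q :=
  let _ : TopologicalSpace G := ⊥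
  have : DiscreteTopology G := ⟨rfl⟩
  { carrier := G
    cont := ⟨fun _ => continuous_of_discreteTopology⟩
    proj := fun g => g • q
    isLocallyConstant_proj := fun _ => isOpen_discrete _
    proj_smul := fun _ _ => mul_smul _ _ _
    base := 1
    proj_base := one_smul _ _ }

section Tower

variable (F : ∀ (n : ℕ) (S : Stage G Q q), AttachData S (n + 1))

/-- The sequence of stages obtained by attaching the cells prescribed by `F`. -/
noncomputable def tower : ℕ → Stage G Q q
  | 0 => vertexStage G q
  | n + 1 => (F n (tower n)).attach

/-- The cells attached to the `n`-th stage. -/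
noncomputable abbrev towerData (n : ℕ) : AttachData (tower F n) (n + 1) := F n (tower F n)

/-- The colimit of the stages. -/
def Colim : Type u := G ⊕ Σ n, FreeSet G (towerData F n).index × OpenBall (n + 1)

/-- The inclusion of a stage. -/
def toColim : ∀ n, (tower F n).carrier → Colim F
  | 0 => Sum.inl
  | n + 1 => Sum.elim (toColim n) fun y => Sum.inr ⟨n, y⟩

theorem toColim_incl (n : ℕ) (x : (tower F n).carrier) :
    toColim F (n + 1) ((towerData F n).incl x) = toColim F n x := rfl

theorem toColim_openCell (n : ℕ) (c : FreeSet G (towerData F n).index) (b : OpenBall (n + 1)) :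
    toColim F (n + 1) ((towerData F n).openCell c b) = Sum.inr ⟨n, (c, b)⟩ := rfl

theorem range_toColim_mono {m n : ℕ} (h : m ≤ n) :
    Set.range (toColim F m) ⊆ Set.range (toColim F n) := by
  induction n, h using Nat.le_induction with
  | base => exact subset_rfl
  | succ n _ ih =>
    refine ih.trans ?_
    rintro _ ⟨x, rfl⟩
    exact ⟨_, toColim_incl F n x⟩

theorem openCell_notMem_range_toColim {m n : ℕ} (h : m ≤ n) (y) :
    (Sum.inr ⟨n, y⟩ : Colim F) ∉ Set.range (toColim F m) := by
  induction m with
  | zero => rintro ⟨x, hx⟩; cases hx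
  | succ m ih =>
    rintro ⟨x, hx⟩
    rcases (towerData F m).incl_or_openCell x with ⟨x, rfl⟩ | ⟨c, b, rfl⟩
    · exact ih (by omega) ⟨x, hx⟩
    · rw [toColim_openCell] at hx
      have := congrArg Sigma.fst (Sum.inr_injective hx)
      dsimp only at this
      omega

theorem toColim_injective (n : ℕ) : Function.Injective (toColim F n) := by
  induction n with
  | zero => exact Sum.inl_injective
  | succ n ih =>
    intro x y h
    rcases (towerData F n).incl_or_openCell x with ⟨x, rfl⟩ | ⟨c, b, rfl⟩ <;>
    rcases (towerData F n).incl_or_openCell y with ⟨y, rfl⟩ | ⟨c', b', rfl⟩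
    · exact congrArg _ (ih h)
    · exact absurd ⟨x, h⟩ (openCell_notMem_range_toColim F le_rfl _)
    · exact absurd ⟨y, h.symm⟩ (openCell_notMem_range_toColim F le_rfl _)
    · exact congrArg Sum.inr (eq_of_heq (Sigma.mk.inj (Sum.inr_injective h)).2)

theorem exists_toColim (x : Colim F) : ∃ n y, toColim F n y = x :=
  match x with
  | Sum.inl g => ⟨0, g, rfl⟩
  | Sum.inr ⟨n, y⟩ => ⟨n + 1, Sum.inr y, rfl⟩

noncomputable instance : TopologicalSpace (Colim F) :=
  ⨆ n, TopologicalSpace.coinduced (toColim F n) inferInstance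

theorem isOpen_colim_iff {s : Set (Colim F)} :
    IsOpen s ↔ ∀ n, IsOpen (toColim F n ⁻¹' s) :=
  isOpen_iSup_iff.trans (forall_congr' fun _ => isOpen_coinduced)

theorem isClosed_colim_iff {s : Set (Colim F)} :
    IsClosed s ↔ ∀ n, IsClosed (toColim F n ⁻¹' s) := by
  simp only [← isOpen_compl_iff, isOpen_colim_iff, Set.preimage_compl]

theorem continuous_toColim (n : ℕ) : Continuous (toColim F n) :=
  continuous_def.2 fun _ hs => (isOpen_colim_iff F).1 hs n

theorem isClosed_preimage_toColim_of_le {m n : ℕ} (h : m ≤ n) {s : Set (Colim F)}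
    (hs : IsClosed (toColim F n ⁻¹' s)) : IsClosed (toColim F m ⁻¹' s) := by
  induction n, h using Nat.le_induction with
  | base => exact hs
  | succ n _ ih => exact ih (hs.preimage (towerData F n).continuous_incl)

theorem isClosedEmbedding_toColim (n : ℕ) : Topology.IsClosedEmbedding (toColim F n) := by
  refine .of_continuous_injective_isClosedMap (continuous_toColim F n) (toColim_injective F n) ?_
  intro s hs
  refine (isClosed_colim_iff F).2 fun m => ?_
  have hs' : IsClosed (toColim F n ⁻¹' (toColim F n '' s)) := by
    rwa [Set.preimage_image_eq _ (toColim_injective F n)]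
  rcases le_total m n with h | h
  · exact isClosed_preimage_toColim_of_le F h hs'
  · induction m, h using Nat.le_induction with
    | base => exact hs'
    | succ m h ih =>
      -- The set comes from stage `n ≤ m`, so the cells added at stage `m + 1` do not meet it in
      -- their interiors.
      have e : toColim F (m + 1) ⁻¹' (toColim F n '' s) =
          (towerData F m).incl '' (toColim F m ⁻¹' (toColim F n '' s)) := by
        ext x
        constructor
        · rintro ⟨y, hy, hyx⟩
          obtain ⟨z, hz⟩ := range_toColim_mono F h ⟨y, rfl⟩
          have : x = (towerData F m).incl z :=
            toColim_injective F (m + 1) (hyx.symm.trans hz.symm)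
          exact ⟨z, ⟨y, hy, hz.symm⟩, this.symm⟩
        · rintro ⟨z, hz, rfl⟩
          exact hz
      rw [e]
      exact (towerData F m).isClosed_image_incl ih

noncomputable instance : MulAction G (Colim F) where
  smul g x := match x with
    | Sum.inl h => Sum.inl (g * h)
    | Sum.inr ⟨n, c, b⟩ => Sum.inr ⟨n, g • c, b⟩
  one_smul x := match x with
    | Sum.inl x => congrArg Sum.inl (one_mul x)
    | Sum.inr ⟨n, c, b⟩ => congrArg
        (fun c => (Sum.inr ⟨n, c, b⟩ :
          G ⊕ Σ n, FreeSet G (towerData F n).index × OpenBall (n + 1))) (one_smul G c)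
  mul_smul g h x := match x with
    | Sum.inl x => congrArg Sum.inl (mul_assoc g h x)
    | Sum.inr ⟨n, c, b⟩ => congrArg
        (fun c => (Sum.inr ⟨n, c, b⟩ :
          G ⊕ Σ n, FreeSet G (towerData F n).index × OpenBall (n + 1))) (mul_smul g h c)

theorem smul_toColim (n : ℕ) (g : G) (x : (tower F n).carrier) :
    g • toColim F n x = toColim F n (g • x) := by
  induction n with
  | zero => rfl
  | succ n ih =>
    rcases (towerData F n).incl_or_openCell x with ⟨x, rfl⟩ | ⟨c, b, rfl⟩
    · exact ih x
    · rfl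

instance : ContinuousConstSMul G (Colim F) where
  continuous_const_smul g := continuous_def.2 fun s hs => (isOpen_colim_iff F).2 fun n => by
    convert hs.preimage ((continuous_toColim F n).comp (continuous_const_smul g)) using 1
    ext x
    simp only [Set.mem_preimage, smul_toColim, Function.comp_apply]

/-- The projection of the colimit to `Q`. -/
noncomputable def colimProj (x : Colim F) : Q :=
  Sum.elim (fun g : G => g • q) (fun y => y.2.1.1 • (towerData F y.1).val y.2.1.2) x

theorem colimProj_toColim (n : ℕ) (x : (tower F n).carrier) :
    colimProj F (toColim F n x) = (tower F n).proj x := by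
  induction n with
  | zero => rfl
  | succ n ih =>
    rcases (towerData F n).incl_or_openCell x with ⟨x, rfl⟩ | ⟨c, b, rfl⟩
    · exact ih x
    · rfl

theorem isLocallyConstant_colimProj : IsLocallyConstant (colimProj F) := by
  intro s
  refine (isOpen_colim_iff F).2 fun n => ?_
  convert (tower F n).isLocallyConstant_proj s using 1
  ext x
  simp only [Set.mem_preimage, colimProj_toColim]

theorem colimProj_smul (g : G) (x : Colim F) : colimProj F (g • x) = g • colimProj F x := by
  obtain ⟨n, x, rfl⟩ := exists_toColim F x
  rw [smul_toColim, colimProj_toColim, colimProj_toColim, Stage.proj_smul]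

/-! ### The CW structure on the colimit -/

/-- The generating cells of the colimit. -/
noncomputable def cellIndex : ℕ → Type u
  | 0 => PUnit
  | n + 1 => (towerData F n).index

/-- The cells of the colimit. -/
abbrev colimCell (n : ℕ) : Type u := FreeSet G (cellIndex F n)

/-- The characteristic maps of the colimit. -/
noncomputable def colimChar : ∀ n, colimCell F n → UnitBall n → Colim F
  | 0, c, _ => Sum.inl c.1
  | n + 1, c, b => toColim F (n + 1) ((towerData F n).char c b)

theorem colimChar_succ (n : ℕ) (c : FreeSet G (towerData F n).index) (b : UnitBall (n + 1)) :
    colimChar F (n + 1) c b = toColim F (n + 1) ((towerData F n).char c b) := rfl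

theorem skeletonLT_colimChar_zero : skeletonLT (colimChar F) 0 = ∅ :=
  Set.eq_empty_of_forall_notMem fun _ ⟨_, h, _⟩ => Nat.not_lt_zero _ h

theorem skeletonLT_colimChar_succ (n : ℕ) :
    skeletonLT (colimChar F) (n + 1) = Set.range (toColim F n) := by
  induction n with
  | zero =>
    ext x
    rw [mem_skeletonLT_succ, skeletonLT_colimChar_zero]
    constructor
    · rintro (h | ⟨c, b, rfl⟩)
      · exact h.elim
      · exact ⟨c.1, rfl⟩
    · rintro ⟨g, rfl⟩
      exact .inr ⟨(g, PUnit.unit), UnitBall.center 0, rfl⟩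
  | succ n ih =>
    ext x
    rw [mem_skeletonLT_succ, ih]
    constructor
    · rintro (h | ⟨c, b, rfl⟩)
      · exact range_toColim_mono F n.le_succ h
      · exact ⟨_, rfl⟩
    · rintro ⟨x, rfl⟩
      rcases (towerData F n).incl_or_openCell x with ⟨x, rfl⟩ | ⟨c, b, rfl⟩
      · exact .inl ⟨x, rfl⟩
      · refine .inr ⟨c, b.1, ?_⟩
        rw [colimChar_succ, AttachData.char_of_lt _ _ b.2]

theorem isClosed_skeletonLT_colimChar (n : ℕ) : IsClosed (skeletonLT (colimChar F) n) := by
  cases n with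
  | zero => rw [skeletonLT_colimChar_zero]; exact isClosed_empty
  | succ n => rw [skeletonLT_colimChar_succ]; exact (isClosedEmbedding_toColim F n).isClosed_range

theorem isClosed_preimage_toColim {n : ℕ} {C : Set (Colim F)}
    (h : IsClosed (C ∩ skeletonLT (colimChar F) (n + 1))) : IsClosed (toColim F n ⁻¹' C) := by
  convert h.preimage (continuous_toColim F n) using 1
  ext x
  rw [skeletonLT_colimChar_succ]
  exact (and_iff_left ⟨x, rfl⟩).symm

theorem isClosed_of_subset_skeletonLT {n : ℕ} {C : Set (Colim F)}
    (hC : C ⊆ skeletonLT (colimChar F) (n + 1)) (h : IsClosed (toColim F n ⁻¹' C)) :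
    IsClosed C := by
  rw [skeletonLT_colimChar_succ] at hC
  rw [← Set.image_preimage_eq_of_subset hC]
  exact (isClosedEmbedding_toColim F n).isClosedMap _ h

theorem colimChar_of_norm_lt {n : ℕ} (c : FreeSet G (towerData F n).index) {b : UnitBall (n + 1)}
    (hb : ‖b.1‖ < 1) : colimChar F (n + 1) c b = Sum.inr ⟨n, (c, ⟨b, hb⟩)⟩ := by
  rw [colimChar_succ, AttachData.char_of_lt _ _ hb, toColim_openCell]

theorem colimChar_of_norm_eq {n : ℕ} (c : FreeSet G (towerData F n).index) {b : UnitBall (n + 1)}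
    (hb : ‖b.1‖ = 1) : colimChar F (n + 1) c b =
      toColim F n (c.1 • (towerData F n).map c.2 ⟨b, hb⟩) := by
  rw [colimChar_succ, AttachData.char_of_eq _ _ hb, toColim_incl]

/-- The colimit of the stages is a projective `G`-CW complex. -/
noncomputable def colimCWStructure : ProjectiveCWStructure G (Colim F) where
  cell := colimCell F
  cellAction := fun _ => inferInstance
  projective _ := FreeSet.isProjectiveSet _ _
  char := colimChar F
  continuous_char n c := by
    cases n with
    | zero => exact continuous_const
    | succ n => exact (continuous_toColim F _).comp ((towerData F n).continuous_char c)
  char_smul n g c b := by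
    cases n with
    | zero => rfl
    | succ n =>
      exact (congrArg (toColim F (n + 1)) ((towerData F n).smul_char g c b).symm).trans
        (smul_toColim F (n + 1) g _).symm
  char_sphere n c b hb := by
    cases n with
    | zero => exact absurd hb b.norm_lt_of_zero.ne
    | succ n =>
      rw [skeletonLT_colimChar_succ, colimChar_of_norm_eq F c hb]
      exact ⟨_, rfl⟩
  char_ball n c b hb := by
    cases n with
    | zero => rw [skeletonLT_colimChar_zero]; exact Set.notMem_empty _
    | succ n =>
      rw [skeletonLT_colimChar_succ, colimChar_of_norm_lt F c hb]
      exact openCell_notMem_range_toColim F le_rfl _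
  char_injOn n c c' b b' hb hb' h := by
    cases n with
    | zero => exact ⟨Prod.ext (Sum.inl_injective h) rfl, by rw [b.eq_center, b'.eq_center]⟩
    | succ n =>
      rw [colimChar_of_norm_lt F c hb, colimChar_of_norm_lt F c' hb'] at h
      have h := eq_of_heq (Sigma.mk.inj (Sum.inr_injective h)).2
      exact ⟨congrArg Prod.fst h, congrArg (fun p => p.2.1) h⟩
  exists_mem_skeletonLT x := by
    obtain ⟨n, y, rfl⟩ := exists_toColim F x
    exact ⟨n + 1, by rw [skeletonLT_colimChar_succ]; exact ⟨y, rfl⟩⟩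
  isClosed_skeletonLT := isClosed_skeletonLT_colimChar F
  isClosed_of_pushout n C hC h₁ h₂ := by
    refine isClosed_of_subset_skeletonLT F hC ?_
    cases n with
    | zero =>
      -- Stage zero is `G` with the discrete topology, so the hypotheses on `C` are not needed in
      -- this case.
      have : DiscreteTopology (tower F 0).carrier := ⟨rfl⟩
      exact isClosed_discrete _
    | succ n => exact (towerData F n).isClosed_iff.2 ⟨isClosed_preimage_toColim F h₁, h₂⟩
  isClosed_of_colimit C h := (isClosed_colim_iff F).2 fun n => isClosed_preimage_toColim F (h _)

end Tower

/-! ### Radial homeomorphisms and extension to cylinders -/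

section Radial

variable {E E' : Type*} [NormedAddCommGroup E] [NormedSpace ℝ E] [NormedAddCommGroup E']
  [NormedSpace ℝ E']

/-- The norm-preserving radial map associated with a linear isomorphism. -/
noncomputable def radialMap (L : E ≃L[ℝ] E') (x : E) : E' := (‖x‖ / ‖L x‖) • L x

theorem norm_radialMap (L : E ≃L[ℝ] E') (x : E) : ‖radialMap L x‖ = ‖x‖ := by
  rcases eq_or_ne x 0 with rfl | hx
  · simp [radialMap]
  · have : ‖L x‖ ≠ 0 := by simpa using hx
    rw [radialMap, norm_smul, norm_div, norm_norm, norm_norm, div_mul_cancel₀ _ this]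

theorem radialMap_symm_radialMap (L : E ≃L[ℝ] E') (x : E) :
    radialMap L.symm (radialMap L x) = x := by
  rcases eq_or_ne x 0 with rfl | hx
  · simp [radialMap]
  · have h₁ : ‖L x‖ ≠ 0 := by simpa using hx
    have h₂ : ‖x‖ ≠ 0 := by simpa using hx
    rw [radialMap, norm_radialMap, radialMap, map_smul, L.symm_apply_apply, norm_smul, norm_div,
      norm_norm, norm_norm, smul_smul]
    have : ‖x‖ / (‖x‖ / ‖L x‖ * ‖x‖) * (‖x‖ / ‖L x‖) = 1 := by field_simp
    rw [this, one_smul]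

theorem continuous_radialMap (L : E ≃L[ℝ] E') : Continuous (radialMap L) := by
  refine continuous_iff_continuousAt.2 fun x => ?_
  rcases eq_or_ne x 0 with rfl | hx
  · have h₀ : radialMap L 0 = 0 := by simp [radialMap]
    rw [ContinuousAt, h₀, tendsto_zero_iff_norm_tendsto_zero]
    simp only [norm_radialMap]
    exact tendsto_norm_zero
  · have : ‖L x‖ ≠ 0 := by simpa using hx
    exact (continuous_norm.continuousAt.div (continuous_norm.comp L.continuous).continuousAt
      this).smul L.continuous.continuousAt

end Radial

section Cylinder

open unitInterval

variable {n : ℕ}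

/-- A linear isomorphism `ℝⁿ × ℝ ≅ ℝⁿ⁺¹`. -/
noncomputable def prodEquiv (n : ℕ) :
    (EuclideanSpace ℝ (Fin n) × ℝ) ≃L[ℝ] EuclideanSpace ℝ (Fin (n + 1)) :=
  ContinuousLinearEquiv.ofFinrankEq (by simp)

theorem UnitSphere.norm_pair_eq_one {v : EuclideanSpace ℝ (Fin n)} {t : ℝ}
    (h : ‖(v, t)‖ = 1) : t = -1 ∨ t = 1 ∨ ‖v‖ = 1 := by
  rw [Prod.norm_def] at h
  rcases max_choice ‖v‖ ‖t‖ with h' | h'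
  · exact .inr (.inr (h'.symm.trans h))
  · rcases eq_or_eq_neg_of_abs_eq ((Real.norm_eq_abs t).symm.trans (h'.symm.trans h)) with h | h
    · exact .inr (.inl h)
    · exact .inl h

theorem exists_continuous_curry {Y X : Type*} [TopologicalSpace Y] [TopologicalSpace X]
    {f : Y × I → X} (hf : Continuous f) :
    ∃ H : Y → C(I, X), Continuous H ∧ ∀ y t, H y t = f (y, t) :=
  ⟨(ContinuousMap.mk f hf).curry, ContinuousMap.continuous _, fun _ _ => rfl⟩

/-- If maps from the `n`-sphere extend over the `(n+1)`-ball, then maps from the boundary of the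
cylinder `Bⁿ × I` extend over the cylinder. -/
theorem exists_cylinder_extension {X : Type*} [TopologicalSpace X] {P P' : X → Prop}
    (hext : ∀ f : UnitSphere (n + 1) → X, Continuous f → (∀ b, P (f b)) →
      ∃ F : UnitBall (n + 1) → X, Continuous F ∧ (∀ b : UnitSphere (n + 1), F b.1 = f b) ∧
        ∀ b, P' (F b))
    {u₀ u₁ : UnitBall n → X} (hu₀ : Continuous u₀) (hu₁ : Continuous u₁)
    {w : UnitSphere n → C(I, X)} (hw : Continuous w) (hw₀ : ∀ b, w b 0 = u₀ b.1)
    (hw₁ : ∀ b, w b 1 = u₁ b.1) (hPu₀ : ∀ b, P (u₀ b)) (hPu₁ : ∀ b, P (u₁ b))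
    (hPw : ∀ b t, P (w b t)) :
    ∃ H : UnitBall n → C(I, X), Continuous H ∧ (∀ b, H b 0 = u₀ b) ∧ (∀ b, H b 1 = u₁ b) ∧
      (∀ b : UnitSphere n, H b.1 = w b) ∧ ∀ b t, P' (H b t) := by
  classical
  -- The product carries the sup norm, so `Z` is the boundary of `Bⁿ × [-1, 1]`; norm-preserving
  -- radial maps identify it with the Euclidean sphere.
  let Z := {z : EuclideanSpace ℝ (Fin n) × ℝ // ‖z‖ = 1}
  let pr : Z → UnitBall n := fun z => ⟨z.1.1, mem_closedBall_zero_iff.2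
    ((norm_fst_le z.1).trans z.2.le)⟩
  have hpr : Continuous pr := (continuous_fst.comp continuous_subtype_val).subtype_mk _
  let τ : ℝ → I := fun t => Set.projIcc 0 1 zero_le_one ((t + 1) / 2)
  have hτ : Continuous τ := continuous_projIcc.comp (by fun_prop)
  have hτ₀ : τ (-1) = 0 := by
    refine (Set.projIcc_of_le_left _ ?_)
    norm_num
  have hτ₁ : τ 1 = 1 := by
    refine (Set.projIcc_of_right_le _ ?_)
    norm_num
  -- Bottom, top and side of the cylinder, in this order. The final `else` is never reached, by
  -- `UnitSphere.norm_pair_eq_one`.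
  let g : Z → X := fun z => if z.1.2 = -1 then u₀ (pr z) else if z.1.2 = 1 then u₁ (pr z) else
    if h : ‖z.1.1‖ = 1 then w ⟨pr z, h⟩ (τ z.1.2) else u₀ (pr z)
  have hg₀ : ∀ z : Z, z.1.2 = -1 → g z = u₀ (pr z) := fun z hz => if_pos hz
  have hg₁ : ∀ z : Z, z.1.2 = 1 → g z = u₁ (pr z) := fun z hz =>
    (if_neg (by rw [hz]; norm_num)).trans (if_pos hz)
  have hgw : ∀ (z : Z) (h : ‖z.1.1‖ = 1), g z = w ⟨pr z, h⟩ (τ z.1.2) := by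
    intro z h
    by_cases h₀ : z.1.2 = -1
    · rw [hg₀ z h₀, h₀, hτ₀, hw₀]
    by_cases h₁ : z.1.2 = 1
    · rw [hg₁ z h₁, h₁, hτ₁, hw₁]
    exact (if_neg h₀).trans ((if_neg h₁).trans (dif_pos h))
  have hgP : ∀ z, P (g z) := by
    intro z
    rcases UnitSphere.norm_pair_eq_one z.2 with h | h | h
    · rw [hg₀ z h]; exact hPu₀ _
    · rw [hg₁ z h]; exact hPu₁ _
    · rw [hgw z h]; exact hPw _ _
  have hsnd : Continuous fun z : Z => z.1.2 := continuous_snd.comp continuous_subtype_val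
  have hfst : Continuous fun z : Z => z.1.1 := continuous_fst.comp continuous_subtype_val
  have hgc : Continuous g := by
    have c₀ : IsClosed {z : Z | z.1.2 = -1} := isClosed_eq hsnd continuous_const
    have c₁ : IsClosed {z : Z | z.1.2 = 1} := isClosed_eq hsnd continuous_const
    have c₂ : IsClosed {z : Z | ‖z.1.1‖ = 1} :=
      isClosed_eq (continuous_norm.comp hfst) continuous_const
    have k₀ : ContinuousOn g {z : Z | z.1.2 = -1} :=
      (hu₀.comp hpr).continuousOn.congr fun z hz => hg₀ z hz
    have k₁ : ContinuousOn g {z : Z | z.1.2 = 1} :=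
      (hu₁.comp hpr).continuousOn.congr fun z hz => hg₁ z hz
    have k₂ : ContinuousOn g {z : Z | ‖z.1.1‖ = 1} := by
      rw [continuousOn_iff_continuous_domRestrict]
      have : Set.domRestrict {z : Z | ‖z.1.1‖ = 1} g =
          fun z => w ⟨pr z.1, z.2⟩ (τ z.1.1.2) := funext fun z => hgw z.1 z.2
      rw [this]
      have h₁ : Continuous fun z : {z : Z | ‖z.1.1‖ = 1} => w ⟨pr z.1, z.2⟩ :=
        hw.comp ((hpr.comp continuous_subtype_val).subtype_mk _)
      have h₂ : Continuous fun z : {z : Z | ‖z.1.1‖ = 1} => τ z.1.1.2 :=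
        hτ.comp (hsnd.comp continuous_subtype_val)
      exact h₁.eval h₂
    have := (k₀.union_of_isClosed k₁ c₀ c₁).union_of_isClosed k₂ (c₀.union c₁) c₂
    rw [← continuousOn_univ]
    refine this.mono fun z _ => ?_
    rcases UnitSphere.norm_pair_eq_one z.2 with h | h | h
    · exact .inl (.inl h)
    · exact .inl (.inr h)
    · exact .inr h
  let L := prodEquiv n
  obtain ⟨F, hF, hFg, hFP⟩ := hext
    (fun b => g ⟨radialMap L.symm b.1.1, (norm_radialMap _ _).trans b.2⟩)
    (hgc.comp (((continuous_radialMap L.symm).comp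
      (continuous_subtype_val.comp continuous_subtype_val)).subtype_mk _)) (fun b => hgP _)
  have hnorm : ∀ (b : UnitBall n) (t : I), ‖((b.1, 2 * (t : ℝ) - 1) :
      EuclideanSpace ℝ (Fin n) × ℝ)‖ ≤ 1 := by
    intro b t
    refine norm_prod_le_iff.2 ⟨b.norm_le, ?_⟩
    rw [Real.norm_eq_abs, abs_le]
    constructor <;> linarith [t.2.1, t.2.2]
  let cyl : UnitBall n × I → UnitBall (n + 1) := fun p =>
    ⟨radialMap L (p.1.1, 2 * (p.2 : ℝ) - 1), mem_closedBall_zero_iff.2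
      ((norm_radialMap _ _).trans_le (hnorm p.1 p.2))⟩
  have hcyl : Continuous cyl :=
    ((continuous_radialMap L).comp (by fun_prop)).subtype_mk _
  have hFcyl : ∀ (b : UnitBall n) (t : I) (h : ‖((b.1, 2 * (t : ℝ) - 1) :
      EuclideanSpace ℝ (Fin n) × ℝ)‖ = 1), F (cyl (b, t)) = g ⟨(b.1, 2 * (t : ℝ) - 1), h⟩ := by
    intro b t h
    refine (hFg ⟨cyl (b, t), (norm_radialMap _ _).trans h⟩).trans ?_
    exact congrArg g (Subtype.ext (radialMap_symm_radialMap L _))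
  obtain ⟨H, hH, hHF⟩ := exists_continuous_curry (hF.comp hcyl)
  refine ⟨H, hH, ?_, ?_, ?_, fun b t => by rw [hHF]; exact hFP _⟩
  · intro b
    have h : ‖((b.1, 2 * ((0 : I) : ℝ) - 1) : EuclideanSpace ℝ (Fin n) × ℝ)‖ = 1 := by
      rw [Prod.norm_def]
      simpa using b.norm_le
    exact (hHF b 0).trans <| (hFcyl b 0 h).trans (hg₀ _ (by simp))
  · intro b
    have h : ‖((b.1, 2 * ((1 : I) : ℝ) - 1) : EuclideanSpace ℝ (Fin n) × ℝ)‖ = 1 := by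
      have : (2 : ℝ) - 1 = 1 := by norm_num
      rw [Prod.norm_def]
      simpa [this] using b.norm_le
    exact (hHF b 1).trans <| (hFcyl b 1 h).trans (hg₁ _ (by norm_num))
  · intro b
    ext t
    have h : ‖((b.1.1, 2 * (t : ℝ) - 1) : EuclideanSpace ℝ (Fin n) × ℝ)‖ = 1 := by
      refine le_antisymm (hnorm b.1 t) ?_
      exact b.2.ge.trans (norm_fst_le ((b.1.1, 2 * (t : ℝ) - 1) : EuclideanSpace ℝ (Fin n) × ℝ))
    refine (hHF b.1 t).trans <| (hFcyl b.1 t h).trans ((hgw ⟨(b.1.1, 2 * (t : ℝ) - 1), h⟩ b.2).trans ?_)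
    have : τ (2 * (t : ℝ) - 1) = t := by
      have e : (2 * (t : ℝ) - 1 + 1) / 2 = t := by ring
      simp only [τ, e]
      exact Set.projIcc_val _ t
    exact congrArg (w b) this

end Cylinder

open unitInterval

/-! ### The classifying space of a connected Cayley graph -/

section Classifying

variable {G Q : Type u} [Monoid G] [MulAction G Q] {q : Q}

/-- Attach all cells whose attaching map lies over a single element of `Q`. -/
def fullData (S : Stage G Q q) (n : ℕ) : AttachData S n where
  index := {p : Q × C(UnitSphere n, S.carrier) // ∀ b, S.proj (p.2 b) = p.1}
  map t := t.1.2
  val t := t.1.1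
  proj_map t b := t.2 b

variable {A : Type u} (s t : A → G) (hst : ∀ a, s a • q = t a • q)

/-- The coordinate never vanishes on `S⁰`, so `0 < ·` and `0 ≤ ·` cut out the same set. This makes
any choice of two end points a continuous attaching map. -/
theorem isClopen_pos_sphere_one : IsClopen {b : UnitSphere 1 | 0 < b.1.1 0} := by
  have hc : Continuous fun b : UnitSphere 1 => b.1.1 0 := by fun_prop
  refine ⟨?_, isOpen_lt continuous_const hc⟩
  convert isClosed_le (continuous_const (y := (0 : ℝ))) hc using 1
  ext b
  refine ⟨fun h => (show (0 : ℝ) < b.1.1 0 from h).le, fun h => ?_⟩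
  refine lt_of_le_of_ne (show (0 : ℝ) ≤ b.1.1 0 from h) fun h₀ => ?_
  have hb := b.2
  have : b.1.1 = 0 := PiLp.ext fun i => by rw [Subsingleton.elim i 0, ← h₀]; rfl
  rw [this, norm_zero] at hb
  exact zero_ne_one hb

/-- Attach an edge from `s a • x` to `t a • x` for all `a`, where `x` is the base point. -/
noncomputable def edgeData (S : Stage G Q q) : AttachData S 1 where
  index := A
  map a := ⟨fun b => if 0 < b.1.1 0 then t a • S.base else s a • S.base, by
    refine continuous_if (fun b hb => ?_) continuousOn_const continuousOn_const
    rw [show {b : UnitSphere 1 | 0 < b.1.1 0} = _ from rfl,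
      isClopen_pos_sphere_one.frontier_eq] at hb
    exact hb.elim⟩
  val a := s a • q
  proj_map a b := by
    change S.proj (if 0 < b.1.1 0 then t a • S.base else s a • S.base) = _
    split_ifs
    · rw [S.proj_smul, S.proj_base, hst]
    · rw [S.proj_smul, S.proj_base]

/-- First attach the prescribed edges, then all cells of higher dimension. -/
noncomputable def killingData : ∀ (n : ℕ) (S : Stage G Q q), AttachData S (n + 1)
  | 0, S => edgeData s t hst S
  | n + 1, S => fullData S (n + 2)

/-- The vertices of the colimit. -/
def colimVertex (F : ∀ (n : ℕ) (S : Stage G Q q), AttachData S (n + 1)) (g : G) : Colim F :=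
  Sum.inl g

theorem colimVertex_mem_skeletonLT (F : ∀ (n : ℕ) (S : Stage G Q q), AttachData S (n + 1)) (g : G)
    (n : ℕ) : colimVertex F g ∈ skeletonLT (colimChar F) (n + 1) :=
  ⟨0, n.succ_pos, (g, PUnit.unit), UnitBall.center 0, rfl⟩

theorem UnitBall.exists_coord_eq {r : ℝ} (hr : |r| = 1) :
    ∃ b : UnitBall 1, ‖b.1‖ = 1 ∧ b.1 0 = r := by
  have hb : ‖EuclideanSpace.single (0 : Fin 1) r‖ = 1 := by simpa using hr
  exact ⟨⟨EuclideanSpace.single 0 r, mem_closedBall_zero_iff.2 hb.le⟩, hb, by simp⟩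

theorem colimChar_edge (g : G) (a : A) {b : UnitBall 1} (hb : ‖b.1‖ = 1) :
    colimChar (killingData s t hst) 1 (g, a) b =
      colimVertex _ (g * (if 0 < b.1 0 then t a else s a)) := by
  have e : (towerData (killingData s t hst) 0).map a ⟨b, hb⟩ =
      if 0 < b.1 0 then t a * 1 else s a * 1 := rfl
  rw [mul_one, mul_one] at e
  exact (colimChar_of_norm_eq (killingData s t hst) (n := 0) (g, a) hb).trans
    (congrArg (fun x : G => colimVertex (killingData s t hst) (g * x)) e)

theorem joinedIn_edge (g : G) (a : A) :
    JoinedIn (skeletonLT (colimChar (killingData s t hst)) 2)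
      (colimVertex (killingData s t hst) (g * s a))
      (colimVertex (killingData s t hst) (g * t a)) := by
  obtain ⟨b, hb, h⟩ := UnitBall.exists_coord_eq (r := -1) (by simp)
  obtain ⟨b', hb', h'⟩ := UnitBall.exists_coord_eq (r := 1) (by simp)
  have e := colimChar_edge s t hst g a hb
  have e' := colimChar_edge s t hst g a hb'
  rw [h, if_neg (by norm_num)] at e
  rw [h', if_pos one_pos] at e'
  rw [← e, ← e']
  obtain ⟨γ⟩ := PathConnectedSpace.joined b b'
  exact ⟨γ.map ((colimCWStructure (killingData s t hst)).continuous_char 1 (g, a)),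
    fun τ => ⟨1, one_lt_two, (g, a), γ τ, rfl⟩⟩

theorem joinedIn_of_eqvGen {g g' : G}
    (h : Relation.EqvGen (fun x y => ∃ k a, x = k * s a ∧ y = k * t a) g g') :
    JoinedIn (skeletonLT (colimChar (killingData s t hst)) 2)
      (colimVertex (killingData s t hst) g) (colimVertex (killingData s t hst) g') := by
  induction h with
  | rel x y h =>
    obtain ⟨k, a, rfl, rfl⟩ := h
    exact joinedIn_edge s t hst k a
  | refl x => exact JoinedIn.refl (colimVertex_mem_skeletonLT _ x 1)
  | symm _ _ _ ih => exact ih.symm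
  | trans _ _ _ _ _ ih₁ ih₂ => exact ih₁.trans ih₂

/-- Maps from spheres of positive dimension to a skeleton extend to the next skeleton. -/
theorem exists_ball_extension (n : ℕ) (y : Q)
    (f : UnitSphere (n + 2) → Colim (killingData s t hst)) (hf : Continuous f)
    (hfP : ∀ b, f b ∈ skeletonLT (colimChar (killingData s t hst)) (n + 2) ∧
      colimProj _ (f b) = y) :
    ∃ F : UnitBall (n + 2) → Colim (killingData s t hst), Continuous F ∧
      (∀ b : UnitSphere (n + 2), F b.1 = f b) ∧
      ∀ b, F b ∈ skeletonLT (colimChar (killingData s t hst)) (n + 3) ∧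
        colimProj _ (F b) = y := by
  let K := killingData s t hst
  have hrange : ∀ b, f b ∈ Set.range (toColim K (n + 1)) := fun b => by
    rw [← skeletonLT_colimChar_succ]
    exact (hfP b).1
  choose f' hf' using hrange
  have hf'c : Continuous f' := by
    rw [(isClosedEmbedding_toColim K (n + 1)).isEmbedding.continuous_iff]
    convert hf using 1
    exact funext hf'
  -- The map `f` is itself the attaching map of one of the cells added next, and the characteristic
  -- map of that cell is the extension.
  let i : (towerData K (n + 1)).index :=
    ⟨(y, ⟨f', hf'c⟩), fun b => by
      rw [← (hfP b).2, ← hf' b]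
      exact (colimProj_toColim K (n + 1) _).symm⟩
  refine ⟨colimChar K (n + 2) (1, i), (colimCWStructure K).continuous_char _ _, fun b => ?_,
    fun b => ⟨⟨n + 2, Nat.lt_succ_self _, _, b, rfl⟩, ?_⟩⟩
  · refine (colimChar_of_norm_eq K (n := n + 1) (1, i) b.2).trans ((hf' b).symm ▸ ?_)
    exact congrArg (toColim K (n + 1)) (one_smul G (f' b))
  · refine (colimProj_toColim K (n + 2) _).trans ?_
    refine ((towerData K (n + 1)).proj_char _ b).trans ?_
    exact one_smul G y

theorem colimProj_eq_of_path {F : ∀ (n : ℕ) (S : Stage G Q q), AttachData S (n + 1)}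
    {Z : Type*} [TopologicalSpace Z] [PreconnectedSpace Z] {f : Z → Colim F} (hf : Continuous f)
    (z z' : Z) : colimProj F (f z) = colimProj F (f z') :=
  ((isLocallyConstant_colimProj F).comp_continuous hf).apply_eq_of_preconnectedSpace z z'

/-- The homotopy contracting the fibres of the projection to `Q`. -/
theorem exists_fibrewise_contraction
    (hgraph : ∀ g g' : G, g • q = g' • q →
      Relation.EqvGen (fun x y => ∃ k a, x = k * s a ∧ y = k * t a) g g')
    (β : Q → G) (hβ : ∀ y, β y • q = y) :
    ∃ R : Colim (killingData s t hst) → C(I, Colim (killingData s t hst)), Continuous R ∧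
      ∀ x, R x 0 = x ∧ R x 1 = colimVertex _ (β (colimProj _ x)) := by
  let K := killingData s t hst
  let S := colimCWStructure K
  have : Nonempty C(I, Colim K) := ⟨ContinuousMap.const _ (colimVertex K 1)⟩
  -- The path from a point of an `n`-cell stays in its fibre and in the `(n + 1)`-skeleton. The
  -- skeleton bound ensures that the spheres met later are filled by cells already available in the
  -- next dimension.
  let P : ℕ → Colim K → C(I, Colim K) → Prop := fun n x γ => γ 0 = x ∧
    γ 1 = colimVertex K (β (colimProj K x)) ∧
    ∀ τ, γ τ ∈ skeletonLT (colimChar K) (n + 2) ∧ colimProj K (γ τ) = colimProj K x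
  obtain ⟨R, hR, hRP⟩ := S.exists_continuous (Y := C(I, Colim K))
    (fun n c u => ∀ b, P n (S.char n c b) (u b)) (by
    intro n c r hr hrP
    cases n with
    | zero =>
      -- The only use of the graph hypothesis: vertices over the same point of `Q` are joined by an
      -- edge path.
      obtain ⟨γ, hγ⟩ := joinedIn_of_eqvGen s t hst (hgraph c.1 (β (c.1 • q)) (hβ _).symm)
      refine ⟨fun _ => γ, continuous_const, fun b hb => absurd hb b.norm_lt_of_zero.ne,
        fun b => ⟨γ.source, γ.target, fun τ => ⟨hγ τ, ?_⟩⟩⟩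
      have := colimProj_eq_of_path γ.continuous τ 0
      rw [γ.source] at this
      exact this
    | succ n =>
      let y := colimProj K (S.char (n + 1) c (UnitBall.center _))
      have hy : ∀ b, colimProj K (S.char (n + 1) c b) = y := fun b =>
        colimProj_eq_of_path (S.continuous_char (n + 1) c) b _
      have hskel : ∀ x ∈ skeletonLT (colimChar K) (n + 1), P n x (r x) := by
        rintro x ⟨k, hk, c', b, rfl⟩
        obtain ⟨h₀, h₁, h₂⟩ := hrP k hk c' b
        exact ⟨h₀, h₁, fun τ => ⟨skeletonLT_mono _ (by omega) (h₂ τ).1, (h₂ τ).2⟩⟩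
      have hsph : ∀ b : UnitSphere (n + 1), P n (S.char (n + 1) c b.1) (r (S.char (n + 1) c b.1)) :=
        fun b => hskel _ (S.char_sphere _ c b.1 b.2)
      -- Bottom: the characteristic map. Top: the constant chosen vertex. Side: the paths already
      -- built on the boundary. Together they form an `(n + 1)`-sphere in the `(n + 1)`-skeleton,
      -- which is filled one dimension higher.
      obtain ⟨H, hH, H₀, H₁, Hw, HP⟩ := exists_cylinder_extension (n := n + 1)
        (P := fun x => x ∈ skeletonLT (colimChar K) (n + 2) ∧ colimProj K x = y)
        (P' := fun x => x ∈ skeletonLT (colimChar K) (n + 3) ∧ colimProj K x = y)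
        (exists_ball_extension s t hst n y)
        (u₀ := S.char (n + 1) c) (u₁ := fun _ => colimVertex K (β y))
        (w := fun b => r (S.char (n + 1) c b.1))
        (S.continuous_char _ c) continuous_const
        (hr.comp_continuous ((S.continuous_char _ c).comp continuous_subtype_val)
          fun b => S.char_sphere _ c b.1 b.2)
        (fun b => (hsph b).1) (fun b => by rw [(hsph b).2.1, hy])
        (fun b => ⟨⟨n + 1, Nat.lt_succ_self _, c, b, rfl⟩, hy b⟩)
        (fun b => ⟨colimVertex_mem_skeletonLT K _ (n + 1), hβ y⟩)
        (fun b τ => ⟨((hsph b).2.2 τ).1, ((hsph b).2.2 τ).2.trans (hy _)⟩)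
      exact ⟨H, hH, fun b hb => Hw ⟨b, hb⟩, fun b => ⟨H₀ b, by rw [H₁, hy], fun τ =>
        ⟨(HP b τ).1, (HP b τ).2.trans (hy b).symm⟩⟩⟩)
  refine ⟨R, hR, fun x => ?_⟩
  obtain ⟨n, k, hk, c, b, rfl⟩ := S.exists_mem_skeletonLT x
  exact ⟨(hRP k c b).1, (hRP k c b).2.1⟩

/-! ### Path components and their contractibility from a fibrewise contraction. -/

theorem joined_iff_of_fibrewise_contraction {X : Type*} [TopologicalSpace X] {p : X → Q}
    (hp : IsLocallyConstant p) {R : X → C(I, X)} {β : Q → X} (hR₀ : ∀ x, R x 0 = x)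
    (hR₁ : ∀ x, R x 1 = β (p x)) {x y : X} : Joined x y ↔ p x = p y := by
  have hpath : ∀ x, Joined x (β (p x)) := fun x => ⟨⟨R x, hR₀ x, hR₁ x⟩⟩
  constructor
  · rintro ⟨γ⟩
    simpa using (hp.comp_continuous γ.continuous).apply_eq_of_preconnectedSpace 0 1
  · intro h
    have := (hpath x)
    rw [h] at this
    exact this.trans (hpath y).symm

/-- Each path `R y` stays in the path component of `y`, so the homotopy restricts; its end point is
constant there because `p` is. -/
theorem contractibleSpace_pathComponent {X : Type*} [TopologicalSpace X] {p : X → Q}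
    (hp : IsLocallyConstant p) {R : X → C(I, X)} (hR : Continuous R) {β : Q → X}
    (hR₀ : ∀ x, R x 0 = x) (hR₁ : ∀ x, R x 1 = β (p x)) (x : X) :
    ContractibleSpace (pathComponent x) := by
  have hmem : ∀ (y : pathComponent x) (τ : I), R y.1 τ ∈ pathComponent x := by
    intro y τ
    refine Joined.trans y.2 ?_
    have : PathConnectedSpace I := isPathConnected_iff_pathConnectedSpace.1
      ((convex_Icc 0 1).isPathConnected ⟨0, by simp⟩)
    have := (PathConnectedSpace.joined (0 : I) τ).map (R y.1).continuous
    rwa [hR₀] at this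
  have hx : β (p x) ∈ pathComponent x := by
    have := hmem ⟨x, mem_pathComponent_self x⟩ 1
    rwa [hR₁] at this
  rw [contractible_iff_id_nullhomotopic]
  refine ⟨⟨β (p x), hx⟩, ⟨⟨⟨fun z => ⟨R z.2.1 z.1, hmem _ _⟩, ?_⟩, ?_, ?_⟩⟩⟩
  · exact ((hR.comp (continuous_subtype_val.comp continuous_snd)).eval continuous_fst).subtype_mk _
  · exact fun y => Subtype.ext (hR₀ y.1)
  · intro y
    refine Subtype.ext ((hR₁ y.1).trans ?_)
    exact congrArg β ((joined_iff_of_fibrewise_contraction hp hR₀ hR₁).1 y.2).symm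

/-- A `G`-set whose points are the components of a Cayley type graph with finitely many generating
edges has a classifying space with finitely generated `1`-skeleton. -/
theorem exists_classifyingSpace [Finite A] (hst : ∀ a, s a • q = t a • q)
    (hq : ∀ y : Q, ∃ g : G, g • q = y)
    (hgraph : ∀ g g' : G, g • q = g' • q →
      Relation.EqvGen (fun x y => ∃ k a, x = k * s a ∧ y = k * t a) g g') :
    ∃ (X : Type u) (_ : TopologicalSpace X) (_ : MulAction G X) (_ : ContinuousConstSMul G X)
      (S : ProjectiveCWStructure G X),
      ((∃ φ : ZerothHomotopy X ≃ Q, ∀ (g : G) (x : X),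
        φ (ZerothHomotopy.mk (g • x)) = g • φ (ZerothHomotopy.mk x)) ∧
      ∀ x : X, ContractibleSpace (pathComponent x)) ∧ ∀ k ≤ 1, IsFGSet G (S.cell k) := by
  choose β hβ using hq
  let K := killingData s t hst
  obtain ⟨R, hR, hR'⟩ := exists_fibrewise_contraction s t hst hgraph β hβ
  have hp := isLocallyConstant_colimProj K
  have hj : ∀ {x y : Colim K}, Joined x y ↔ colimProj K x = colimProj K y :=
    joined_iff_of_fibrewise_contraction (β := fun y => colimVertex K (β y)) hp
      (fun x => (hR' x).1) (fun x => (hR' x).2)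
  refine ⟨Colim K, inferInstance, inferInstance, inferInstance, colimCWStructure K,
    ⟨⟨Equiv.ofBijective (Quotient.lift (colimProj K) fun x y h => hj.1 h) ⟨?_, ?_⟩, ?_⟩, ?_⟩, ?_⟩
  · intro c d
    induction c, d using Quotient.inductionOn₂ with
    | h x y => exact fun h => Quotient.sound (hj.2 h)
  · exact fun y => ⟨ZerothHomotopy.mk (colimVertex K (β y)), hβ y⟩
  · exact fun g x => colimProj_smul K g x
  · exact contractibleSpace_pathComponent (β := fun y => colimVertex K (β y)) hp hR
      (fun x => (hR' x).1) (fun x => (hR' x).2)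
  · intro k hk
    have : Finite (cellIndex K k) := by
      match k, hk with
      | 0, _ => exact inferInstanceAs (Finite PUnit)
      | 1, _ => exact inferInstanceAs (Finite A)
    exact FreeSet.isFGSet G (cellIndex K k)

end Classifying

theorem isBiF_one_of_bijective {M : Type u} [Monoid M] {A : Set M} (hfin : A.Finite)
    (hA : Function.Bijective (componentToMonoid A)) : IsBiF M 1 := by
  have := hfin.to_subtype
  let _ : MulAction (M × Mᵐᵒᵖ) M :=
    { smul := fun g m => g.1 * m * g.2.unop
      one_smul := fun m => by
        change 1 * m * 1 = m
        rw [one_mul, mul_one]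
      mul_smul := fun g h m => by
        change g.1 * h.1 * m * (h.2.unop * g.2.unop) = g.1 * (h.1 * m * h.2.unop) * g.2.unop
        simp only [mul_assoc] }
  have hsmul : ∀ g : M × Mᵐᵒᵖ, g • (1 : M) = g.1 * g.2.unop := fun g =>
    congrArg (· * g.2.unop) (mul_one g.1)
  refine exists_classifyingSpace (G := M × Mᵐᵒᵖ) (Q := M) (q := 1) (A := A)
    -- Translating by `(x, op y)` turns these two end points into `(x, op (a * y))` and `(x * a, op
    -- y)`, the ends of an edge of the two-sided Cayley digraph.
    (fun a => (1, MulOpposite.op (a : M))) (fun a => ((a : M), 1)) ?_ ?_ ?_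
  · intro a
    rw [hsmul, hsmul]
    simp
  · exact fun m => ⟨(m, 1), (hsmul _).trans (mul_one m)⟩
  · intro g g' h
    rw [hsmul, hsmul] at h
    have h' := (component_eq_iff A).1
      (hA.1 h : component A (g.1, g.2.unop) = component A (g'.1, g'.2.unop))
    have key : ∀ v w : M × M, Relation.EqvGen
        (fun v w : M × M => ∃ x y, ∃ a ∈ A, v = (x, a * y) ∧ w = (x * a, y)) v w →
        Relation.EqvGen (fun x y : M × Mᵐᵒᵖ => ∃ k, ∃ a : A,
          x = k * (1, MulOpposite.op (a : M)) ∧ y = k * ((a : M), 1))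
          (v.1, MulOpposite.op v.2) (w.1, MulOpposite.op w.2) := by
      intro v w h
      induction h with
      | rel v w h =>
        obtain ⟨x, y, a, ha, rfl, rfl⟩ := h
        exact .rel _ _ ⟨(x, MulOpposite.op y), ⟨a, ha⟩, by simp, by simp⟩
      | refl => exact .refl _
      | symm _ _ _ ih => exact .symm _ _ ih
      | trans _ _ _ _ _ ih₁ ih₂ => exact .trans _ _ _ ih₁ ih₂
    exact key _ _ h'

end BiFinite

theorem theoremt (M : Type u) [Monoid M] :
    List.TFAE
      [BiFinite.IsBiF M 1,
       BiFinite.IsBiFP M 1,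
       ∃ A : Set M, A.Finite ∧ Function.Bijective (BiFinite.componentToMonoid A),
       ∃ A : Set M, A.Finite ∧ BiFinite.Dominates A] ∧
    (Monoid.FG M → BiFinite.IsBiF M 1) := by
  have h₄₃ : (∃ A : Set M, A.Finite ∧ BiFinite.Dominates A) →
      ∃ A : Set M, A.Finite ∧ Function.Bijective (BiFinite.componentToMonoid A) :=
    fun ⟨A, hA, h⟩ => ⟨A, hA, h.bijective_componentToMonoid⟩
  have h₃₁ : (∃ A : Set M, A.Finite ∧ Function.Bijective (BiFinite.componentToMonoid A)) →
      BiFinite.IsBiF M 1 := fun ⟨_, hA, h⟩ => BiFinite.isBiF_one_of_bijective hA h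
  constructor
  · tfae_have 1 → 4 := BiFinite.exists_finite_dominates_of_isBiF
    tfae_have 2 → 4 := BiFinite.exists_finite_dominates_of_isBiFP
    tfae_have 4 → 3 := h₄₃
    tfae_have 3 → 1 := h₃₁
    tfae_have 3 → 2 := fun ⟨_, hA, h⟩ => BiFinite.isBiFP_one_of_bijective hA h
    tfae_finish
  · rintro ⟨A, hA⟩
    exact h₃₁ (h₄₃ ⟨A, A.finite_toSet, BiFinite.dominates_of_closure_eq_top hA⟩)
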